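/- Let $V=\mathbb C^3$ with basis $f_1,f_2,f_3$, let $\psi_k^{ij}\in L_2=\mathrm{Hom}(\bigwedge^2V,V)$ ($i<j$) be the map sending $f_i\wedge f_j$ to $f_k$ and the other basis bivectors to $0$. A Lie algebra structure on $V$ is an element $d\in L_2$ with $d^2=0$ (the Jacobi identity); two are equivalent, $d\sim d'$, if $d'=g^{-1}\circ d\circ(g\wedge g)$ for some $g\in GL(V)$. The moduli space is the set of equivalence classes. Put $$d_1=\psi_1^{23}\ (=\mathfrak n_3),\quad d_2=\psi_1^{13}+\psi_2^{23},\quad d_3=\psi_3^{12}+\psi_2^{13}+\psi_1^{23}\ (=\mathfrak{sl}_2),\quad d(\alpha:\beta)=\alpha\psi_1^{13}+\psi_1^{23}+\beta\psi_2^{23},$$ the last for $(\alpha,\beta)\neq(0,0)$. A formal algebra is a commutative local $\mathbb C$-algebra $B$ with augmentation $\varepsilon:B\to\mathbb C$ and maximal ideal $\mathfrak m=\ker\varepsilon$ such that $B\cong\varprojlim B/\mathfrak m^k$; it is infinitesimal if $\mathfrak m^2=0$. A deformation of $d$ with base $B$ is a Lie algebra structure $d_B$ on $V\otimes B$ over $B$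 with $\varepsilon_*d_B=d$; equivalence of deformations is by automorphisms of $V\otimes B$ reducing to $1_V$ under $\varepsilon$. A deformation $d_A$ over a formal algebra $A$ is miniversal if every deformation over every formal algebra $B$ is equivalent to $f_*d_A$ for some homomorphism $f:A\to B$, and $f$ is unique whenever $B$ is infinitesimal. An infinitesimal deformation is universal if the same holds, with unique $f$, among infinitesimal deformations. A jump deformation from $d$ to $d'$ is a family $D_s$ of Lie algebra structures on $V$ analytic in $s\in\mathbb C$ near $0$ with $D_0=d$, $D_s\sim d'$ for all small $s\ne0$, and $d\not\sim d'$. For parameters $t=(t^1,\dots,t^5)$ put $$d^\infty(t)=\psi_1^{23}+t^1\psi_1^{12}+t^2\psi_3^{12}+t^3\psi_1^{13}+t^4\psi_2^{13}+t^5(\psi_3^{13}-\psi_2^{12}).$$ 1. The cocycles $\psi_1^{12},\psi_3^{12},\psi_1^{13},\psi_2^{13},\psi_3^{13}-\psi_2^{12}$ represent a basis of $H^2(d_1)$, and $d^\infty(t)$ over $\mathbb C[t^1,\dots,t^5]/(t^1,\dots,t^5)^2$ is a universal infinitesimal deformation of $d_1$. The same expression $d^\infty(t)$, with base $\mathbb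 C[[t^1,\dots,t^5]]/(t^1t^4+t^3t^5,\ t^1t^5-t^2t^3)$, is a miniversal deformation of $d_1$. 2. For $t\in\mathbb C^5$, $d^\infty(t)$ is a Lie algebra structure if and only if $t^1t^4+t^3t^5=0=t^1t^5-t^2t^3$. The solution set is the union of three pieces: $S_1=\{t^1=t^3=0\}$, of dimension $3$; $S_2=\{t^3=t^4=t^5=0\}$, of dimension $2$; and $S_3=\{t^3\ne0,\ t^5=-t^1t^4/t^3,\ t^2=-(t^1)^2t^4/(t^3)^2\}$, of dimension $3$. 3. Through these pieces $d_1$ has the following jump deformations. In each of the following cases there is a polynomial curve $c:\mathbb C\to\mathbb C^5$ with $c(0)=0$, $c(1)=t$ and $c(s)\in S_i$ for all $s\neq0$, such that $d^\infty(c(s))\sim d'$ for all $s\ne0$, and $s\mapsto d^\infty(c(s))$ is a jump deformation from $d_1$ to $d'$: (a) $i=1$, $t\in S_1$ with $t^2t^4+(t^5)^2\ne0$, $d'=d_3$; (b) $i=1$, $0\neq t\in S_1$ with $t^2t^4+(t^5)^2=0$, $d'=d(1:-1)$; (c) $i=2$, $t\in S_2$ with $t^1=\alpha+\beta$, $t^2=\alpha\beta$,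 $(\alpha,\beta)\ne(0,0)$, $d'=d(\alpha:\beta)$; (d) $i=3$, $t\in S_3$ with $t^3=\alpha+\beta$, $t^4=-\alpha\beta$, $d'=d(\alpha:\beta)$. 4. Hence $d_1$ has jump deformations to $d_3$, to $d(1:-1)$ and to every $d(\alpha:\beta)$, $(\alpha:\beta)\in\mathbb P^1$. More precisely, for a Lie algebra structure $d'$ on $V$ there is a jump deformation from $d_1$ to $d'$ if and only if $d'\ne0$, $d'\not\sim d_1$ and $d'\not\sim d_2$: apart from the class of $d_1$ itself and the abelian structure, $d_1$ jumps to every point of the moduli space except $d_2$. -/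

import Mathlib

universe u v

namespace Lie3

/-- The free module `V ⊗ B`, where `V` is the standard three dimensional space with basis
`f₁, f₂, f₃` (indexed here by `0, 1, 2 : Fin 3`). -/
abbrev Vec (B : Type u) : Type u := Fin 3 → B

/-- `L_k ⊗ B`: alternating `B`-multilinear maps `⋀ᵏ V_B → V_B`, where `V_B = V ⊗ B`. -/
abbrev Cochain (B : Type u) [CommRing B] (k : ℕ) : Type u := Vec B [⋀^Fin k]→ₗ[B] Vec B

section Cochains

variable {B : Type u} [CommRing B]

theorem add_left (φ : Cochain B 2) (a a' b : Vec B) :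
    φ ![a + a', b] = φ ![a, b] + φ ![a', b] := φ.map_vecCons_add ![b] a a'

theorem smul_left (φ : Cochain B 2) (c : B) (a b : Vec B) :
    φ ![c • a, b] = c • φ ![a, b] := φ.map_vecCons_smul ![b] c a

theorem self_eq_zero (φ : Cochain B 2) (a : Vec B) : φ ![a, a] = 0 :=
  φ.map_eq_zero_of_eq ![a, a] (i := 0) (j := 1) rfl (by decide)

theorem swap (φ : Cochain B 2) (a b : Vec B) : φ ![a, b] = - φ ![b, a] := by
  have h := φ.map_swap ![b, a] (i := 0) (j := 1) (by decide)
  rw [← h]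
  congr 1
  ext i
  fin_cases i <;> simp

theorem add_right (φ : Cochain B 2) (a b b' : Vec B) :
    φ ![a, b + b'] = φ ![a, b] + φ ![a, b'] := by
  rw [swap, add_left, swap φ a b, swap φ a b']; abel

theorem smul_right (φ : Cochain B 2) (c : B) (a b : Vec B) :
    φ ![a, c • b] = c • φ ![a, b] := by
  rw [swap, smul_left, swap φ a b, smul_neg]

theorem zero_left (φ : Cochain B 2) (b : Vec B) : φ ![0, b] = 0 := by
  simpa using smul_left φ 0 0 b

/-- An alternating map of two variables from a function of two variables. -/
def mk₂ (F : Vec B → Vec B → Vec B)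
    (hadd : ∀ a a' b, F (a + a') b = F a b + F a' b)
    (hsmul : ∀ (c : B) a b, F (c • a) b = c • F a b)
    (hadd' : ∀ a b b', F a (b + b') = F a b + F a b')
    (hsmul' : ∀ (c : B) a b, F a (c • b) = c • F a b)
    (hself : ∀ a, F a a = 0) : Cochain B 2 where
  toFun v := F (v 0) (v 1)
  map_update_add' v i x y := by
    obtain rfl := Subsingleton.elim ‹DecidableEq (Fin 2)› (instDecidableEqFin 2)
    fin_cases i <;> simp [hadd, hadd', Function.update]
  map_update_smul' v i c x := by
    obtain rfl := Subsingleton.elim ‹DecidableEq (Fin 2)› (instDecidableEqFin 2)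
    fin_cases i <;> simp [hsmul, hsmul', Function.update]
  map_eq_zero_of_eq' v i j h hij := by
    fin_cases i <;> fin_cases j <;> simp_all

/-- An alternating map of three variables from a function of three variables. -/
def mk₃ (F : Vec B → Vec B → Vec B → Vec B)
    (hadd₁ : ∀ a a' b c, F (a + a') b c = F a b c + F a' b c)
    (hsmul₁ : ∀ (r : B) a b c, F (r • a) b c = r • F a b c)
    (hadd₂ : ∀ a b b' c, F a (b + b') c = F a b c + F a b' c)
    (hsmul₂ : ∀ (r : B) a b c, F a (r • b) c = r • F a b c)
    (hadd₃ : ∀ a b c c', F a b (c + c') = F a b c + F a b c')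
    (hsmul₃ : ∀ (r : B) a b c, F a b (r • c) = r • F a b c)
    (h₁₂ : ∀ a b, F a a b = 0) (h₁₃ : ∀ a b, F a b a = 0) (h₂₃ : ∀ a b, F a b b = 0) :
    Cochain B 3 where
  toFun v := F (v 0) (v 1) (v 2)
  map_update_add' v i x y := by
    obtain rfl := Subsingleton.elim ‹DecidableEq (Fin 3)› (instDecidableEqFin 3)
    fin_cases i <;> simp [hadd₁, hadd₂, hadd₃, Function.update]
  map_update_smul' v i c x := by
    obtain rfl := Subsingleton.elim ‹DecidableEq (Fin 3)› (instDecidableEqFin 3)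
    fin_cases i <;> simp [hsmul₁, hsmul₂, hsmul₃, Function.update]
  map_eq_zero_of_eq' v i j h hij := by
    fin_cases i <;> fin_cases j <;> simp_all

/-- The composition `φψ` of two elements of `L₂`, as coderivations:
`(φψ)(a, b, c) = φ(ψ(a, b), c) - φ(ψ(a, c), b) + φ(ψ(b, c), a)`. -/
def comp (φ ψ : Cochain B 2) : Cochain B 3 :=
  mk₃ (fun a b c => φ ![ψ ![a, b], c] - φ ![ψ ![a, c], b] + φ ![ψ ![b, c], a])
    (by intros; simp only [add_left, add_right]; abel)
    (by intros; simp only [smul_left, smul_right, smul_sub, smul_add])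
    (by intros; simp only [add_left, add_right]; abel)
    (by intros; simp only [smul_left, smul_right, smul_sub, smul_add])
    (by intros; simp only [add_left, add_right]; abel)
    (by intros; simp only [smul_left, smul_right, smul_sub, smul_add])
    (by intros; simp only [self_eq_zero, zero_left]; abel)
    (by
      intro a b
      rw [swap ψ b a, ← neg_one_smul B (ψ ![a, b]), smul_left, self_eq_zero, zero_left]
      simp)
    (by intros; simp only [self_eq_zero, zero_left]; abel)

theorem comp_apply (φ ψ : Cochain B 2) (a b c : Vec B) :
    comp φ ψ ![a, b, c] = φ ![ψ ![a, b], c] - φ ![ψ ![a, c], b] + φ ![ψ ![b, c], a] := rfl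

/-- `d ∈ L₂ ⊗ B` is a codifferential if `d² = 0`; this is the Jacobi identity, so that a
codifferential is the same thing as a Lie algebra structure on `B³`. -/
def IsCodifferential (d : Cochain B 2) : Prop := comp d d = 0

/-- The coboundary `D : L₁ → L₂`, `D φ = [d, φ] = dφ - φd`. -/
def D₁ (d : Cochain B 2) : (Vec B →ₗ[B] Vec B) →ₗ[B] Cochain B 2 where
  toFun φ := mk₂ (fun a b => d ![φ a, b] + d ![a, φ b] - φ (d ![a, b]))
    (by intros; simp only [map_add, add_left]; abel)
    (by intros; simp only [map_smul, smul_left, smul_sub, smul_add])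
    (by intros; simp only [map_add, add_right]; abel)
    (by intros; simp only [map_smul, smul_right, smul_sub, smul_add])
    (by intro a; rw [swap d a (φ a), self_eq_zero]; simp)
  map_add' φ ψ := by
    ext v : 1
    simp only [mk₂, AlternatingMap.coe_mk, MultilinearMap.coe_mk, AlternatingMap.add_apply,
      LinearMap.add_apply, add_left, add_right]
    abel
  map_smul' c φ := by
    ext v : 1
    simp only [mk₂, AlternatingMap.coe_mk, MultilinearMap.coe_mk, AlternatingMap.smul_apply,
      LinearMap.smul_apply, smul_left, smul_right, smul_sub, smul_add, RingHom.id_apply]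

/-- The coboundary `D : L₂ → L₃`, `D ψ = [d, ψ] = dψ + ψd`. -/
def D₂ (d : Cochain B 2) : Cochain B 2 →ₗ[B] Cochain B 3 where
  toFun ψ := comp d ψ + comp ψ d
  map_add' φ ψ := by
    ext v : 1
    simp only [comp, mk₃, AlternatingMap.coe_mk, MultilinearMap.coe_mk, AlternatingMap.add_apply,
      add_left]
    abel
  map_smul' c φ := by
    ext v : 1
    simp only [comp, mk₃, AlternatingMap.coe_mk, MultilinearMap.coe_mk, AlternatingMap.smul_apply,
      AlternatingMap.add_apply, smul_left, smul_sub, smul_add, RingHom.id_apply]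

/-- `δ` is a prebasis of `H²(d) = ker (D : L₂ → L₃) / im (D : L₁ → L₂)`: the `δ i` are cocycles
whose classes form a basis of `H²(d)`, that is, every cocycle is, modulo coboundaries, a linear
combination of the `δ i` with unique coefficients. -/
def IsPrebasisH2 {ι : Type v} [Fintype ι] (d : Cochain B 2) (δ : ι → Cochain B 2) : Prop :=
  (∀ i, δ i ∈ LinearMap.ker (D₂ d)) ∧
    ∀ ψ ∈ LinearMap.ker (D₂ d), ∃! c : ι → B, ψ - ∑ i, c i • δ i ∈ LinearMap.range (D₁ d)

/-- The basis element `ψ_k^{ij}` of `L₂` (for `i < j`): it sends `f_i ∧ f_j` to `f_k` and the other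
basis elements of `⋀² V` to `0`. -/
def psi (B : Type u) [CommRing B] (i j k : Fin 3) : Cochain B 2 :=
  mk₂ (fun a b => (a i * b j - a j * b i) • (Pi.single k 1 : Vec B))
    (by intros; rw [← add_smul]; congr 1; simp only [Pi.add_apply]; ring)
    (by intros; rw [← mul_smul]; congr 1; simp only [Pi.smul_apply, smul_eq_mul]; ring)
    (by intros; rw [← add_smul]; congr 1; simp only [Pi.add_apply]; ring)
    (by intros; rw [← mul_smul]; congr 1; simp only [Pi.smul_apply, smul_eq_mul]; ring)
    (by intro a; rw [mul_comm, sub_self, zero_smul])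

/-- The structure constant: the coefficient of `f_k` in `d(f_i, f_j)`. -/
def coeff (d : Cochain B 2) (i j k : Fin 3) : B := d ![Pi.single i 1, Pi.single j 1] k

/-- `f_* : L₂ ⊗ B → L₂ ⊗ C` for a homomorphism `f : B → C`: apply `f` to the coefficients in the
basis `ψ_k^{ij}`, `i < j`. -/
def push {C : Type v} [CommRing C] (f : B →+* C) (d : Cochain B 2) : Cochain C 2 :=
  ∑ k, (f (coeff d 0 1 k) • psi C 0 1 k + f (coeff d 0 2 k) • psi C 0 2 k
    + f (coeff d 1 2 k) • psi C 1 2 k)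

/-- `g^* d = g⁻¹ ∘ d ∘ g`. -/
def pull (g : Vec B ≃ₗ[B] Vec B) (d : Cochain B 2) : Cochain B 2 :=
  (g.symm : Vec B →ₗ[B] Vec B).compAlternatingMap (d.compLinearMap (g : Vec B →ₗ[B] Vec B))

/-- Equivalence of codifferentials, that is, isomorphism of Lie algebra structures. -/
def Equivalent (d d' : Cochain B 2) : Prop := ∃ g : Vec B ≃ₗ[B] Vec B, pull g d = d'

end Cochains

section Deformations

variable {B : Type u} [CommRing B] [Algebra ℂ B]

/-- Infinitesimal equivalence of deformations with base `B` and augmentation `ε : B → ℂ`: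
equivalence through an automorphism of `V ⊗ B` that reduces to the identity of `V`. -/
def InfEquivalent (ε : B →ₐ[ℂ] ℂ) (d d' : Cochain B 2) : Prop :=
  ∃ g : Vec B ≃ₗ[B] Vec B,
    (∀ i j, ε (g (Pi.single j 1) i) = (1 : Matrix (Fin 3) (Fin 3) ℂ) i j) ∧ pull g d = d'

/-- A formal algebra: a local `ℂ`-algebra `B` with augmentation `ε : B → ℂ`, whose maximal ideal is
`𝔪 = ker ε`, such that `B → lim B/𝔪ᵏ` is bijective. -/
structure IsFormalAlgebra (ε : B →ₐ[ℂ] ℂ) : Prop where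
  isLocalRing : IsLocalRing B
  isAdicComplete : IsAdicComplete (RingHom.ker ε) B

/-- An infinitesimal algebra: a local `ℂ`-algebra with augmentation and `𝔪² = 0`. -/
structure IsInfinitesimalAlgebra (ε : B →ₐ[ℂ] ℂ) : Prop where
  isLocalRing : IsLocalRing B
  sq_eq_bot : (RingHom.ker ε) ^ 2 = ⊥

/-- `dB` is a codifferential over `B` which reduces to `d` along the augmentation. -/
def IsDeformation (ε : B →ₐ[ℂ] ℂ) (d : Cochain ℂ 2) (dB : Cochain B 2) : Prop :=
  IsCodifferential dB ∧ push (ε : B →+* ℂ) dB = d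

end Deformations

/-- `dA` (with base `A`) is a universal infinitesimal deformation of `d`. -/
def IsUniversalInfinitesimal {A : Type v} [CommRing A] [Algebra ℂ A] (εA : A →ₐ[ℂ] ℂ)
    (d : Cochain ℂ 2) (dA : Cochain A 2) : Prop :=
  IsInfinitesimalAlgebra εA ∧ IsDeformation εA d dA ∧
    ∀ (B : Type u) [CommRing B] [Algebra ℂ B] (ε : B →ₐ[ℂ] ℂ) (dB : Cochain B 2),
      IsInfinitesimalAlgebra ε → IsDeformation ε d dB →
        ∃! f : A →ₐ[ℂ] B, InfEquivalent ε (push (f : A →+* B) dA) dB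

/-- `dA` (with base `A`) is a versal formal deformation of `d`. -/
def IsVersal {A : Type v} [CommRing A] [Algebra ℂ A] (εA : A →ₐ[ℂ] ℂ)
    (d : Cochain ℂ 2) (dA : Cochain A 2) : Prop :=
  IsFormalAlgebra εA ∧ IsDeformation εA d dA ∧
    ∀ (B : Type u) [CommRing B] [Algebra ℂ B] (ε : B →ₐ[ℂ] ℂ) (dB : Cochain B 2),
      IsFormalAlgebra ε → IsDeformation ε d dB →
        ∃ f : A →ₐ[ℂ] B, InfEquivalent ε (push (f : A →+* B) dA) dB

/-- `dA` (with base `A`) is a miniversal deformation of `d`: it is versal, and the homomorphism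
`f : A → B` is unique whenever `B` is an infinitesimal algebra. -/
def IsMiniversal {A : Type v} [CommRing A] [Algebra ℂ A] (εA : A →ₐ[ℂ] ℂ)
    (d : Cochain ℂ 2) (dA : Cochain A 2) : Prop :=
  IsVersal.{u} εA d dA ∧
    ∀ (B : Type u) [CommRing B] [Algebra ℂ B] (ε : B →ₐ[ℂ] ℂ) (dB : Cochain B 2),
      IsInfinitesimalAlgebra ε → IsDeformation ε d dB →
        ∃! f : A →ₐ[ℂ] B, InfEquivalent ε (push (f : A →+* B) dA) dB

/-- The family `D` of Lie algebra structures, given for small `s ∈ ℂ` by convergent power series,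
is a jump deformation from `d` to `d'`: `D 0 = d`, all `D s` with `s ≠ 0` small are equivalent to
`d'`, and `d` is not equivalent to `d'`. -/
def IsJumpDeformation (d d' : Cochain ℂ 2) (D : ℂ → Cochain ℂ 2) : Prop :=
  (∀ᶠ s in nhds (0 : ℂ), IsCodifferential (D s)) ∧
  (∀ i j k, AnalyticAt ℂ (fun s => coeff (D s) i j k) 0) ∧
  D 0 = d ∧
  (∀ᶠ s in nhdsWithin (0 : ℂ) {0}ᶜ, Equivalent (D s) d') ∧
  ¬ Equivalent d d'

/-- There is a jump deformation from `d` to `d'`. -/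
def JumpsTo (d d' : Cochain ℂ 2) : Prop := ∃ D : ℂ → Cochain ℂ 2, IsJumpDeformation d d' D

/-- The Heisenberg algebra `𝔫₃`: `d₁ = ψ₁²³`. -/
def d1 (B : Type u) [CommRing B] : Cochain B 2 := psi B 1 2 0

/-- `d₂ = ψ₁¹³ + ψ₂²³`. -/
def d2 : Cochain ℂ 2 := psi ℂ 0 2 0 + psi ℂ 1 2 1

/-- `d₃ = ψ₃¹² + ψ₂¹³ + ψ₁²³`, the simple Lie algebra `𝔰𝔩₂(ℂ)`. -/
def d3 : Cochain ℂ 2 := psi ℂ 0 1 2 + psi ℂ 0 2 1 + psi ℂ 1 2 0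

/-- `d(α : β) = α ψ₁¹³ + ψ₁²³ + β ψ₂²³`. -/
def dFam (α β : ℂ) : Cochain ℂ 2 := α • psi ℂ 0 2 0 + psi ℂ 1 2 0 + β • psi ℂ 1 2 1

/-- `δ₁, …, δ₅ = ψ₁¹², ψ₃¹², ψ₁¹³, ψ₂¹³, ψ₃¹³ - ψ₂¹²`. -/
def delta (B : Type u) [CommRing B] : Fin 5 → Cochain B 2 :=
  ![psi B 0 1 0, psi B 0 1 2, psi B 0 2 0, psi B 0 2 1, psi B 0 2 2 - psi B 0 1 1]

/-- `d₁ + t¹ δ₁ + … + t⁵ δ₅`, with parameters in `B` (`tⁱ` is `t (i - 1)`). -/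
def dInf {B : Type u} [CommRing B] (t : Fin 5 → B) : Cochain B 2 :=
  d1 B + ∑ i, t i • delta B i

/-- The ideal `(t¹, …, t⁵)²` of `ℂ[t¹, …, t⁵]`. -/
noncomputable def infIdeal : Ideal (MvPolynomial (Fin 5) ℂ) :=
  (Ideal.span (Set.range MvPolynomial.X)) ^ 2

/-- `ℂ[t¹, …, t⁵]/(t¹, …, t⁵)²`. -/
abbrev InfBase : Type := MvPolynomial (Fin 5) ℂ ⧸ infIdeal

/-- The augmentation of `ℂ[t¹, …, t⁵]/(t¹, …, t⁵)²`: evaluation at `0`. -/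
noncomputable def infAug : InfBase →ₐ[ℂ] ℂ :=
  Ideal.Quotient.liftₐ infIdeal (MvPolynomial.aeval fun _ => (0 : ℂ)) (by
    have h : infIdeal ≤ RingHom.ker (MvPolynomial.aeval (R := ℂ) fun _ : Fin 5 => (0 : ℂ)) := by
      refine (Ideal.pow_le_self two_ne_zero).trans (Ideal.span_le.2 ?_)
      rintro _ ⟨i, rfl⟩
      simp [RingHom.mem_ker]
    exact fun a ha => h ha)

/-- The parameters in `ℂ[t¹, …, t⁵]/(t¹, …, t⁵)²`. -/
noncomputable def infParam (i : Fin 5) : InfBase := Ideal.Quotient.mk infIdeal (MvPolynomial.X i)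

/-- The ideal `(t¹t⁴ + t³t⁵, t¹t⁵ - t²t³)` of `ℂ[[t¹, …, t⁵]]`. -/
noncomputable def relIdeal : Ideal (MvPowerSeries (Fin 5) ℂ) :=
  Ideal.span {MvPowerSeries.X 0 * MvPowerSeries.X 3 + MvPowerSeries.X 2 * MvPowerSeries.X 4,
    MvPowerSeries.X 0 * MvPowerSeries.X 4 - MvPowerSeries.X 1 * MvPowerSeries.X 2}

/-- `ℂ[[t¹, …, t⁵]]/(t¹t⁴ + t³t⁵, t¹t⁵ - t²t³)`. -/
abbrev Base : Type := MvPowerSeries (Fin 5) ℂ ⧸ relIdeal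

/-- The augmentation of `ℂ[[t¹, …, t⁵]]/(t¹t⁴ + t³t⁵, t¹t⁵ - t²t³)`: the constant coefficient. -/
noncomputable def baseAug : Base →ₐ[ℂ] ℂ :=
  Ideal.Quotient.liftₐ relIdeal
    ({ (MvPowerSeries.constantCoeff : MvPowerSeries (Fin 5) ℂ →+* ℂ) with
        commutes' := fun c => MvPowerSeries.constantCoeff_C c } :
      MvPowerSeries (Fin 5) ℂ →ₐ[ℂ] ℂ) (by
    have h : relIdeal ≤
        RingHom.ker (MvPowerSeries.constantCoeff : MvPowerSeries (Fin 5) ℂ →+* ℂ) := by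
      refine Ideal.span_le.2 ?_
      rintro _ (rfl | rfl) <;> simp [RingHom.mem_ker]
    exact fun a ha => h ha)

/-- The parameters in `ℂ[[t¹, …, t⁵]]/(t¹t⁴ + t³t⁵, t¹t⁵ - t²t³)`. -/
noncomputable def baseParam (i : Fin 5) : Base := Ideal.Quotient.mk relIdeal (MvPowerSeries.X i)

/-- The solution set of the two relations in `ℂ⁵`. -/
def Sol : Set (Fin 5 → ℂ) :=
  {t | t 0 * t 3 + t 2 * t 4 = 0 ∧ t 0 * t 4 - t 1 * t 2 = 0}

/-- First piece: `t¹ = t³ = 0`. -/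
def Sol₁ : Set (Fin 5 → ℂ) := {t | t 0 = 0 ∧ t 2 = 0}

/-- Second piece: `t³ = t⁴ = t⁵ = 0`. -/
def Sol₂ : Set (Fin 5 → ℂ) := {t | t 2 = 0 ∧ t 3 = 0 ∧ t 4 = 0}

/-- Third piece: `t³ ≠ 0`, `t⁵ = -t¹t⁴/t³`, `t² = -(t¹)²t⁴/(t³)²`. -/
def Sol₃ : Set (Fin 5 → ℂ) :=
  {t | t 2 ≠ 0 ∧ t 4 = -(t 0 * t 3) / t 2 ∧ t 1 = -(t 0 ^ 2 * t 3) / t 2 ^ 2}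

/-- The dimension of a subset of `ℂ⁵` (that is, of its Zariski closure): the Krull dimension of its
ring of polynomial functions. -/
noncomputable def algDim (S : Set (Fin 5 → ℂ)) : WithBot ℕ∞ :=
  ringKrullDim (MvPolynomial (Fin 5) ℂ ⧸ MvPolynomial.vanishingIdeal ℂ S)

/-- Inside `S ⊆ ℂ⁵` there is a polynomial curve `c` from the origin through `t` along which the
family `dInf` is a jump deformation from `d₁` to `d'`. -/
def JumpsThrough (S : Set (Fin 5 → ℂ)) (t : Fin 5 → ℂ) (d' : Cochain ℂ 2) : Prop :=
  ∃ c : Fin 5 → Polynomial ℂ,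
    (∀ i, (c i).eval 0 = 0) ∧ (∀ i, (c i).eval 1 = t i) ∧
    (∀ s : ℂ, s ≠ 0 → (fun i => (c i).eval s) ∈ S ∧ Equivalent (dInf fun i => (c i).eval s) d') ∧
    IsJumpDeformation (d1 ℂ) d' (fun s => dInf fun i => (c i).eval s)

end Lie3

/-!
The whole theorem rests on one change of basis. Let `d` be a Lie algebra structure on `B³` over any
commutative ring `B`, and let `a`, `b` be vectors such that `d(a, b), a, b` is a basis. In this basis
`d(f₂, f₃) = f₁`, and the `f₁`-component of the single Jacobi identity of `B³` says that the
coefficients of `ψ₂¹²` and `ψ₃¹³` are opposite. So `d` becomes a member of the family `d^∞`, and its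
parameters satisfy the two remaining components of the Jacobi identity, which are the two relations
(`exists_pull_eq_dInf`, `isCodifferential_dInf_iff`).

*Versality.* For a deformation of `d₁` over a local base, the vectors `a = f₂`, `b = f₃` qualify,
because `d(f₂, f₃), f₂, f₃` reduces to the standard basis of `V`; the change of basis also reduces to
the identity. Hence every deformation is equivalent to `d^∞(t)` for some parameters `t` in the maximal
ideal that satisfy the relations, with no induction over the order of the deformation
(`IsDeformation.exists_infEquivalent_dInf`). If the base is formal, evaluation of power series at `t`
is the required homomorphism. Over a base with `𝔪² = 0`, comparing the coefficients of two equivalent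
members of the family shows that `t` is unique (`InfEquivalent.eq_of_ker_sq_eq_bot`), and a
homomorphism to such a base is determined by its values on the parameters
(`algHom_ext_of_ker_eq_span`). The base `ℂ[[t]]/(relations)` is Hausdorff by Krull's intersection
theorem and complete as a quotient of the power series ring.

*Jumps along the pieces.* On each piece an explicit basis identifies `d^∞(t)` with `d₃` or with some
`d(α : β)`. Each piece is stable under a scaling `tⁱ ↦ s^{nᵢ} tⁱ` with positive weights that does not
change this isomorphism type, and `s ↦ (s^{nᵢ} tⁱ)` is the curve (`jumpsThrough_of_weights`).

*The moduli space.* If `d' ≠ 0` is not isomorphic to `d₂`, there are `a`, `b` with `d'(a, b), a, b`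
independent: otherwise `d'(a, b) = l(b) a - l(a) b` for a linear form `l`, which is zero or `d₂`.
So `d'` is isomorphic to a member of the family `d^∞`, and the previous paragraph gives the jump unless
`t = 0`. Conversely the coefficient of `ψ₁²³` is continuous, equals `1` for `d₁`, and vanishes for all
structures isomorphic to `0` or `d₂` (`not_jumpsTo_of_coeff_eq_zero`).

*Dimensions.* The first two pieces are linear. The third is parametrized by `(a, b, e)` with `b ≠ 0`;
its Zariski closure strictly contains a plane and is strictly contained in an irreducible
hypersurface, which leaves only the dimension `3`.
-/

namespace Lie3

/-! ### Cochains in coordinates and the normal form -/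

section CochainBasics

variable {B : Type u} [CommRing B]

/-- The standard basis vector `f_i` of `V ⊗ B`. -/
abbrev basisVec (B : Type u) [CommRing B] (i : Fin 3) : Vec B := Pi.single i 1

theorem eq_sum_basisVec (a : Vec B) :
    a = a 0 • basisVec B 0 + (a 1 • basisVec B 1 + a 2 • basisVec B 2) := by
  funext i
  fin_cases i <;> simp [basisVec]

theorem cochain_apply (d : Cochain B 2) (a b : Vec B) :
    d ![a, b] = (a 0 * b 1 - a 1 * b 0) • d ![basisVec B 0, basisVec B 1]
      + (a 0 * b 2 - a 2 * b 0) • d ![basisVec B 0, basisVec B 2]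
      + (a 1 * b 2 - a 2 * b 1) • d ![basisVec B 1, basisVec B 2] := by
  conv_lhs => rw [eq_sum_basisVec a, eq_sum_basisVec b]
  simp only [add_left, add_right, smul_left, smul_right, self_eq_zero]
  rw [swap d (basisVec B 1) (basisVec B 0), swap d (basisVec B 2) (basisVec B 0),
    swap d (basisVec B 2) (basisVec B 1)]
  module

theorem cochain_apply_coord (d : Cochain B 2) (a b : Vec B) (k : Fin 3) :
    d ![a, b] k = (a 0 * b 1 - a 1 * b 0) * coeff d 0 1 k
      + (a 0 * b 2 - a 2 * b 0) * coeff d 0 2 k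
      + (a 1 * b 2 - a 2 * b 1) * coeff d 1 2 k := by
  rw [cochain_apply]
  rfl

theorem cochain_ext {d d' : Cochain B 2} (h₀₁ : ∀ k, coeff d 0 1 k = coeff d' 0 1 k)
    (h₀₂ : ∀ k, coeff d 0 2 k = coeff d' 0 2 k) (h₁₂ : ∀ k, coeff d 1 2 k = coeff d' 1 2 k) :
    d = d' := by
  ext v k
  have hv : v = ![v 0, v 1] := by
    funext i
    fin_cases i <;> rfl
  rw [hv, cochain_apply_coord, cochain_apply_coord, h₀₁, h₀₂, h₁₂]

@[simp] theorem coeff_add (d d' : Cochain B 2) (i j k : Fin 3) :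
    coeff (d + d') i j k = coeff d i j k + coeff d' i j k := rfl

@[simp] theorem coeff_sub (d d' : Cochain B 2) (i j k : Fin 3) :
    coeff (d - d') i j k = coeff d i j k - coeff d' i j k := rfl

@[simp] theorem coeff_smul (c : B) (d : Cochain B 2) (i j k : Fin 3) :
    coeff (c • d) i j k = c * coeff d i j k := rfl

@[simp] theorem coeff_zero (i j k : Fin 3) : coeff (0 : Cochain B 2) i j k = 0 := rfl

theorem coeff_psi (p q r i j k : Fin 3) :
    coeff (psi B p q r) i j k =
      ((Pi.single i 1 : Vec B) p * (Pi.single j 1 : Vec B) q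
        - (Pi.single i 1 : Vec B) q * (Pi.single j 1 : Vec B) p) * (Pi.single r 1 : Vec B) k := rfl

theorem coeff_dInf (t : Fin 5 → B) (i j k : Fin 3) :
    coeff (dInf t) i j k = coeff (psi B 1 2 0) i j k + (t 0 * coeff (psi B 0 1 0) i j k
      + t 1 * coeff (psi B 0 1 2) i j k + t 2 * coeff (psi B 0 2 0) i j k
      + t 3 * coeff (psi B 0 2 1) i j k
      + t 4 * (coeff (psi B 0 2 2) i j k - coeff (psi B 0 1 1) i j k)) := by
  simp [dInf, d1, delta, Fin.sum_univ_five]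

theorem coeff_dInf_zero_one (t : Fin 5 → B) :
    (fun k => coeff (dInf t) 0 1 k) = ![t 0, -t 4, t 1] := by
  funext k
  fin_cases k <;> simp [coeff_dInf, coeff_psi]

theorem coeff_dInf_zero_two (t : Fin 5 → B) :
    (fun k => coeff (dInf t) 0 2 k) = ![t 2, t 3, t 4] := by
  funext k
  fin_cases k <;> simp [coeff_dInf, coeff_psi]

theorem coeff_dInf_one_two (t : Fin 5 → B) :
    (fun k => coeff (dInf t) 1 2 k) = ![1, 0, 0] := by
  funext k
  fin_cases k <;> simp [coeff_dInf, coeff_psi]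

theorem dInf_apply (t : Fin 5 → B) (a b : Vec B) :
    dInf t ![a, b] = (a 0 * b 1 - a 1 * b 0) • ![t 0, -t 4, t 1]
      + (a 0 * b 2 - a 2 * b 0) • ![t 2, t 3, t 4]
      + (a 1 * b 2 - a 2 * b 1) • ![1, 0, 0] := by
  rw [← coeff_dInf_zero_one, ← coeff_dInf_zero_two, ← coeff_dInf_one_two, cochain_apply]
  rfl

theorem d1_eq_dInf : d1 B = dInf 0 := by
  simp [dInf]

/-- A cochain with `d(f₂, f₃) = f₁` and `ψ₂¹²`, `ψ₃¹³` coefficients opposite to each other lies in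
the family `d^∞`. -/
theorem eq_dInf {d : Cochain B 2} (h : d ![basisVec B 1, basisVec B 2] = basisVec B 0)
    (h' : coeff d 0 1 1 + coeff d 0 2 2 = 0) :
    d = dInf ![coeff d 0 1 0, coeff d 0 1 2, coeff d 0 2 0, coeff d 0 2 1, coeff d 0 2 2] := by
  refine cochain_ext (fun k => ?_) (fun k => ?_) (fun k => ?_)
  · rw [congrFun (coeff_dInf_zero_one _) k]
    fin_cases k
    · rfl
    · exact eq_neg_of_add_eq_zero_left h'
    · rfl
  · rw [congrFun (coeff_dInf_zero_two _) k]
    fin_cases k <;> rfl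
  · rw [congrFun (coeff_dInf_one_two _) k, coeff, h]
    fin_cases k <;> simp [basisVec]

theorem cochain₃_eq_zero {ω : Cochain B 3}
    (h : ω ![basisVec B 0, basisVec B 1, basisVec B 2] = 0) : ω = 0 := by
  refine Module.Basis.ext_alternating (Pi.basisFun B (Fin 3)) fun v hv => ?_
  obtain ⟨σ, rfl⟩ : ∃ σ : Equiv.Perm (Fin 3), v = σ :=
    ⟨Equiv.ofBijective v (Finite.injective_iff_bijective.1 hv), rfl⟩
  have h' : (fun i => Pi.basisFun B (Fin 3) (σ i))
      = ![basisVec B 0, basisVec B 1, basisVec B 2] ∘ σ := by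
    funext i
    simp only [Pi.basisFun_apply, Function.comp]
    generalize σ i = j
    fin_cases j <;> rfl
  rw [h', AlternatingMap.map_perm, h, smul_zero]
  rfl

/-- The Jacobi identity for the single triple `f₁, f₂, f₃`. -/
theorem isCodifferential_iff (d : Cochain B 2) :
    IsCodifferential d ↔ d ![d ![basisVec B 0, basisVec B 1], basisVec B 2]
      - d ![d ![basisVec B 0, basisVec B 2], basisVec B 1]
      + d ![d ![basisVec B 1, basisVec B 2], basisVec B 0] = 0 := by
  rw [← comp_apply]
  exact ⟨fun h => by rw [h]; rfl, cochain₃_eq_zero⟩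

theorem dInf_basisVec_zero_one (t : Fin 5 → B) :
    dInf t ![basisVec B 0, basisVec B 1] = ![t 0, -t 4, t 1] := by
  simp [dInf_apply, basisVec]

theorem dInf_basisVec_zero_two (t : Fin 5 → B) :
    dInf t ![basisVec B 0, basisVec B 2] = ![t 2, t 3, t 4] := by
  simp [dInf_apply, basisVec]

theorem dInf_basisVec_one_two (t : Fin 5 → B) :
    dInf t ![basisVec B 1, basisVec B 2] = basisVec B 0 := by
  funext k
  fin_cases k <;> simp [dInf_apply, basisVec]

theorem isCodifferential_dInf_iff (t : Fin 5 → B) :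
    IsCodifferential (dInf t) ↔ t 0 * t 3 + t 2 * t 4 = 0 ∧ t 0 * t 4 - t 1 * t 2 = 0 := by
  rw [isCodifferential_iff, dInf_basisVec_zero_one, dInf_basisVec_zero_two, dInf_basisVec_one_two,
    self_eq_zero, add_zero, dInf_apply, dInf_apply, funext_iff, Fin.forall_fin_succ,
    Fin.forall_fin_two]
  simp only [basisVec, Pi.sub_apply, Pi.add_apply, Pi.smul_apply, Pi.zero_apply, smul_eq_mul,
    Matrix.cons_val, Pi.single_apply]
  simp only [Fin.reduceEq, if_true, if_false]
  constructor
  · rintro ⟨-, h₁, h₂⟩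
    simp at h₁ h₂
    exact ⟨by linear_combination h₁, by linear_combination h₂⟩
  · rintro ⟨h₁, h₂⟩
    refine ⟨?_, ?_, ?_⟩
    · simp; ring
    · simp; linear_combination h₁
    · simp; linear_combination h₂

theorem pull_apply (g : Vec B ≃ₗ[B] Vec B) (d : Cochain B 2) (a b : Vec B) :
    pull g d ![a, b] = g.symm (d ![g a, g b]) := by
  have h : (fun i => g (![a, b] i)) = ![g a, g b] := by
    funext i
    fin_cases i <;> rfl
  rw [← h]
  rfl

theorem pull_eq_iff (g : Vec B ≃ₗ[B] Vec B) (d d' : Cochain B 2) :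
    pull g d = d' ↔ ∀ a b, d ![g a, g b] = g (d' ![a, b]) := by
  constructor
  · rintro rfl a b
    rw [pull_apply, g.apply_symm_apply]
  · intro h
    refine cochain_ext (fun k => ?_) (fun k => ?_) (fun k => ?_) <;>
      rw [coeff, pull_apply, h, g.symm_apply_apply] <;> rfl

theorem pull_eq_symm {g : Vec B ≃ₗ[B] Vec B} {d d' : Cochain B 2} (h : pull g d = d') :
    pull g.symm d' = d := by
  rw [pull_eq_iff] at h ⊢
  intro a b
  rw [LinearEquiv.eq_symm_apply, ← h, g.apply_symm_apply, g.apply_symm_apply]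

theorem pull_eq_of_basisVec {g : Vec B ≃ₗ[B] Vec B} {d d' : Cochain B 2}
    (h₀₁ : d ![g (basisVec B 0), g (basisVec B 1)] = g (d' ![basisVec B 0, basisVec B 1]))
    (h₀₂ : d ![g (basisVec B 0), g (basisVec B 2)] = g (d' ![basisVec B 0, basisVec B 2]))
    (h₁₂ : d ![g (basisVec B 1), g (basisVec B 2)] = g (d' ![basisVec B 1, basisVec B 2])) :
    pull g d = d' := by
  refine cochain_ext (fun k => ?_) (fun k => ?_) (fun k => ?_)
  · rw [coeff, pull_apply, h₀₁, g.symm_apply_apply]; rfl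
  · rw [coeff, pull_apply, h₀₂, g.symm_apply_apply]; rfl
  · rw [coeff, pull_apply, h₁₂, g.symm_apply_apply]; rfl

theorem IsCodifferential.pull {d : Cochain B 2} (h : IsCodifferential d)
    (g : Vec B ≃ₗ[B] Vec B) : IsCodifferential (pull g d) := by
  have h' := congrArg (fun ω : Cochain B 3 =>
    g.symm (ω ![g (basisVec B 0), g (basisVec B 1), g (basisVec B 2)])) h
  simp only [comp_apply, AlternatingMap.zero_apply, map_zero, map_add, map_sub] at h'
  rw [isCodifferential_iff]
  simp only [pull_apply, g.apply_symm_apply]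
  exact h'

theorem Equivalent.symm {d d' : Cochain B 2} (h : Equivalent d d') : Equivalent d' d :=
  h.imp' _ fun _ => pull_eq_symm

theorem Equivalent.trans {d d' d'' : Cochain B 2} (h : Equivalent d d') (h' : Equivalent d' d'') :
    Equivalent d d'' := by
  obtain ⟨g, hg⟩ := h
  obtain ⟨g', hg'⟩ := h'
  rw [pull_eq_iff] at hg hg'
  refine ⟨g'.trans g, (pull_eq_iff _ _ _).2 fun a b => ?_⟩
  rw [LinearEquiv.trans_apply, LinearEquiv.trans_apply, LinearEquiv.trans_apply, hg, hg']

/-- Three vectors of invertible determinant are the images of the standard basis under an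
automorphism. -/
theorem exists_linearEquiv (v : Fin 3 → Vec B) (hv : IsUnit (Matrix.of v).det) :
    ∃ g : Vec B ≃ₗ[B] Vec B, ∀ i, g (basisVec B i) = v i := by
  have hv' : IsUnit (LinearMap.toMatrix (Pi.basisFun B (Fin 3)) (Pi.basisFun B (Fin 3))
      (Matrix.toLin' (Matrix.of v).transpose)).det := by
    rw [← Matrix.toLin_eq_toLin', LinearMap.toMatrix_toLin, Matrix.det_transpose]
    exact hv
  refine ⟨LinearEquiv.ofIsUnitDet hv', fun i => ?_⟩
  funext k
  simp [LinearEquiv.ofIsUnitDet, basisVec]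

theorem linearEquiv_apply (g : Vec B ≃ₗ[B] Vec B) (a : Vec B) :
    g a = a 0 • g (basisVec B 0) + a 1 • g (basisVec B 1) + a 2 • g (basisVec B 2) := by
  conv_lhs => rw [eq_sum_basisVec a]
  simp only [map_add, map_smul, add_assoc]

/-- An equivalence given by a basis `v` in which `d` has the structure constants of `d'`. -/
theorem equivalent_of_basis {d d' : Cochain B 2} (v : Fin 3 → Vec B)
    (hv : IsUnit (Matrix.of v).det)
    (h₀₁ : d ![v 0, v 1] = coeff d' 0 1 0 • v 0 + coeff d' 0 1 1 • v 1 + coeff d' 0 1 2 • v 2)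
    (h₀₂ : d ![v 0, v 2] = coeff d' 0 2 0 • v 0 + coeff d' 0 2 1 • v 1 + coeff d' 0 2 2 • v 2)
    (h₁₂ : d ![v 1, v 2] = coeff d' 1 2 0 • v 0 + coeff d' 1 2 1 • v 1 + coeff d' 1 2 2 • v 2) :
    Equivalent d d' := by
  obtain ⟨g, hg⟩ := exists_linearEquiv v hv
  refine ⟨g, pull_eq_of_basisVec ?_ ?_ ?_⟩
  · rw [linearEquiv_apply g (d' _), hg, hg, hg, h₀₁]; rfl
  · rw [linearEquiv_apply g (d' _), hg, hg, hg, h₀₂]; rfl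
  · rw [linearEquiv_apply g (d' _), hg, hg, hg, h₁₂]; rfl

/-- Normal form of a Lie algebra structure having two vectors `a`, `b` such that `d(a, b), a, b`
is a basis: in this basis the `f₁`-component of the Jacobi identity reads `ψ₂¹² + ψ₃¹³ = 0` for the
coefficients, so that the structure belongs to the family `d^∞`. -/
theorem exists_pull_eq_dInf {d : Cochain B 2} (hd : IsCodifferential d) (a b : Vec B)
    (hab : IsUnit (Matrix.of ![d ![a, b], a, b]).det) :
    ∃ (g : Vec B ≃ₗ[B] Vec B) (t : Fin 5 → B), g (basisVec B 0) = d ![a, b] ∧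
      g (basisVec B 1) = a ∧ g (basisVec B 2) = b ∧ pull g d = dInf t := by
  obtain ⟨g, hg⟩ := exists_linearEquiv _ hab
  have h₁₂ : pull g d ![basisVec B 1, basisVec B 2] = basisVec B 0 := by
    rw [pull_apply, hg, hg, LinearEquiv.symm_apply_eq, hg]
    rfl
  have hJ := (isCodifferential_iff _).1 (hd.pull g)
  rw [h₁₂, self_eq_zero, add_zero] at hJ
  -- the `f₁`-component is the linear condition
  have hJ₀ := congrFun hJ 0
  have hz : coeff (pull g d) 1 2 0 = 1 := by rw [coeff, h₁₂]; simp [basisVec]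
  simp only [Pi.sub_apply, cochain_apply_coord, hz] at hJ₀
  refine ⟨g, _, hg 0, hg 1, hg 2, eq_dInf h₁₂ ?_⟩
  simp [basisVec] at hJ₀
  simp only [coeff] at hJ₀ ⊢
  linear_combination hJ₀

end CochainBasics

/-! ### Invariants of the structures in the list -/

section Invariants

theorem d2_apply (a b : Vec ℂ) : d2 ![a, b] = b 2 • a - a 2 • b := by
  funext k
  rw [cochain_apply_coord]
  fin_cases k <;> simp [d2, coeff_psi] <;> ring

theorem coeff_d1_one_two_zero : coeff (d1 ℂ) 1 2 0 = 1 := by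
  simp [d1, coeff_psi]

/-- `d₁` is two-step nilpotent. -/
theorem d1_d1_apply (a b c : Vec ℂ) : d1 ℂ ![d1 ℂ ![a, b], c] = 0 := by
  simp [d1_eq_dInf, dInf_apply]

theorem apply_apply_of_equivalent_d1 {d : Cochain ℂ 2} (h : Equivalent (d1 ℂ) d)
    (a b c : Vec ℂ) : d ![d ![a, b], c] = 0 := by
  obtain ⟨g, rfl⟩ := h
  rw [pull_apply, pull_apply, g.apply_symm_apply, d1_d1_apply, map_zero]

theorem not_equivalent_d1_d3 : ¬ Equivalent (d1 ℂ) d3 := by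
  intro h
  have h' := congrFun (apply_apply_of_equivalent_d1 h (basisVec ℂ 1) (basisVec ℂ 2)
    (basisVec ℂ 1)) 2
  simp only [cochain_apply_coord] at h'
  simp [d3, coeff_psi, basisVec] at h'

theorem not_equivalent_d1_dFam {α β : ℂ} (hαβ : α ≠ 0 ∨ β ≠ 0) :
    ¬ Equivalent (d1 ℂ) (dFam α β) := by
  intro h
  have h' := apply_apply_of_equivalent_d1 h (basisVec ℂ 1) (basisVec ℂ 2) (basisVec ℂ 2)
  have h₀ := congrFun h' 0
  have h₁ := congrFun h' 1
  simp only [cochain_apply_coord] at h₀ h₁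
  simp [dFam, coeff_psi, basisVec] at h₀ h₁
  subst h₁
  simp at h₀ hαβ
  exact hαβ h₀

end Invariants

/-! ### Isomorphism types along the three pieces -/

section Equivalences

/-- `d(α : β)` depends, up to isomorphism, only on the point `(α : β)` of the projective line. -/
theorem equivalent_dFam_smul {s : ℂ} (hs : s ≠ 0) (α β : ℂ) :
    Equivalent (dFam (s * α) (s * β)) (dFam α β) := by
  refine equivalent_of_basis ![![1, 0, 0], ![0, s, 0], ![0, 0, s⁻¹]] ?_ ?_ ?_ ?_
  · simp [Matrix.det_fin_three, hs]
  all_goals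
    funext k
    rw [cochain_apply_coord]
    fin_cases k <;> simp [dFam, coeff_psi] <;> try field_simp

/-- On the second piece, `[· , f₂]` acts on the abelian ideal spanned by `f₁`, `f₃` with eigenvalues
`α`, `β`, and `f₃` is a cyclic vector. -/
theorem equivalent_dFam_of_mem_sol₂ {t : Fin 5 → ℂ} (ht : t ∈ Sol₂) {α β : ℂ}
    (h₀ : t 0 = α + β) (h₁ : t 1 = α * β) : Equivalent (dInf t) (dFam α β) := by
  obtain ⟨h₂, h₃, h₄⟩ := ht
  refine equivalent_of_basis ![![-1, 0, -β], ![0, 0, 1], ![0, 1, 0]] ?_ ?_ ?_ ?_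
  · simp [Matrix.det_fin_three]
  all_goals
    funext k
    rw [dInf_apply]
    fin_cases k <;> simp [dFam, coeff_psi, h₀, h₁, h₂, h₃, h₄]

/-- On the third piece, `w = f₂ - (t¹/t³) f₃` commutes with `f₁`, and `[· , f₃]` acts on the abelian
ideal spanned by `f₁`, `w` with eigenvalues `α`, `β` and cyclic vector `w`. -/
theorem equivalent_dFam_of_mem_sol₃ {t : Fin 5 → ℂ} (ht : t ∈ Sol₃) {α β : ℂ}
    (h₂ : t 2 = α + β) (h₃ : t 3 = -(α * β)) : Equivalent (dInf t) (dFam α β) := by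
  obtain ⟨hne, h₄, h₁⟩ := ht
  obtain ⟨k, hk⟩ : ∃ k, t 0 = k * t 2 := ⟨t 0 / t 2, by field_simp⟩
  replace h₄ : t 4 = -(k * t 3) := by rw [h₄, hk]; field_simp
  replace h₁ : t 1 = -(k ^ 2 * t 3) := by rw [h₁, hk]; field_simp
  refine equivalent_of_basis ![![1, -β, β * k], ![0, 1, -k], ![0, 0, 1]] ?_ ?_ ?_ ?_
  · simp [Matrix.det_fin_three]
  all_goals
    funext j
    rw [dInf_apply]
    fin_cases j <;> simp [dFam, coeff_psi, hk, h₁, h₂, h₃, h₄] <;> ring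

/-- On the first piece, `N = [f₁, ·]` is a traceless endomorphism of the plane spanned by `f₂`, `f₃`;
the quadratic form `u ↦ u ∧ N u` takes every value as soon as `N ≠ 0`. -/
theorem exists_quadratic_eq {x y z : ℂ} (h : x ≠ 0 ∨ y ≠ 0 ∨ z ≠ 0) (c : ℂ) :
    ∃ p q : ℂ, x * p ^ 2 + 2 * z * p * q - y * q ^ 2 = c := by
  obtain ⟨p, q, hpq⟩ : ∃ p q : ℂ, x * p ^ 2 + 2 * z * p * q - y * q ^ 2 ≠ 0 := by
    -- a quadratic form in two variables vanishing at `(1, 0)`, `(0, 1)`, `(1, 1)` is zero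
    by_contra! H
    have h₁ := H 1 0
    have h₂ := H 0 1
    have h₃ := H 1 1
    simp at h₁ h₂
    simp [h₁, h₂] at h₃
    simp [h₁, h₂, h₃] at h
  obtain ⟨r, hr⟩ := IsAlgClosed.exists_pow_nat_eq
    (c / (x * p ^ 2 + 2 * z * p * q - y * q ^ 2)) two_pos
  refine ⟨r * p, r * q, ?_⟩
  rw [eq_div_iff hpq] at hr
  linear_combination hr

/-- With `N = [f₁, ·]`, `N² = r²` and `u ∧ N u = 1`, the vectors `f₁/r, u, N u/r` form a standard
basis of `𝔰𝔩₂`. -/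
theorem equivalent_d3_of_mem_sol₁ {t : Fin 5 → ℂ} (ht : t ∈ Sol₁)
    (hq : t 1 * t 3 + t 4 ^ 2 ≠ 0) : Equivalent (dInf t) d3 := by
  obtain ⟨h₀, h₂⟩ := ht
  obtain ⟨r, hr⟩ := IsAlgClosed.exists_pow_nat_eq (t 1 * t 3 + t 4 ^ 2) two_pos
  have hr₀ : r ≠ 0 := by
    rintro rfl
    exact hq (by rw [← hr]; simp)
  obtain ⟨p, q, hpq⟩ : ∃ p q : ℂ, t 1 * p ^ 2 + 2 * t 4 * p * q - t 3 * q ^ 2 = 1 := by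
    refine exists_quadratic_eq ?_ 1
    by_contra! H
    simp [H] at hq
  refine equivalent_of_basis ![![r⁻¹, 0, 0], ![0, p, q],
    ![0, r⁻¹ * (t 3 * q - t 4 * p), r⁻¹ * (t 1 * p + t 4 * q)]] ?_ ?_ ?_ ?_
  · have : r⁻¹ * (p * (r⁻¹ * (t 1 * p + t 4 * q))) - r⁻¹ * (q * (r⁻¹ * (t 3 * q - t 4 * p)))
        = r⁻¹ * r⁻¹ := by linear_combination r⁻¹ * r⁻¹ * hpq
    simp only [Matrix.det_fin_three, isUnit_iff_ne_zero]
    simp [mul_assoc, this, hr₀]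
  all_goals
    funext j
    rw [dInf_apply]
    fin_cases j <;> simp [d3, coeff_psi, h₀, h₂]
  · ring
  · ring
  · field_simp
    linear_combination -p * hr
  · field_simp
    linear_combination -q * hr
  · field_simp
    linear_combination hpq

/-- With `N = [f₁, ·]`, `N² = 0`, `u ∧ N u = -1` and `w = N u`, the operator `[u, ·]` exchanges `f₁`
and `-w` on the abelian ideal spanned by `f₁`, `w`, so that its eigenvalues are `1`, `-1`. -/
theorem equivalent_dFam_of_mem_sol₁ {t : Fin 5 → ℂ} (ht : t ∈ Sol₁)
    (hq : t 1 * t 3 + t 4 ^ 2 = 0) (hne : t ≠ 0) : Equivalent (dInf t) (dFam 1 (-1)) := by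
  obtain ⟨h₀, h₂⟩ := ht
  obtain ⟨p, q, hpq⟩ : ∃ p q : ℂ, t 1 * p ^ 2 + 2 * t 4 * p * q - t 3 * q ^ 2 = -1 := by
    refine exists_quadratic_eq ?_ (-1)
    by_contra! H
    refine hne (funext fun i => ?_)
    fin_cases i <;> simp [h₀, h₂, H]
  obtain ⟨w₁, hw₁⟩ : ∃ w, w = t 3 * q - t 4 * p := ⟨_, rfl⟩
  obtain ⟨w₂, hw₂⟩ : ∃ w, w = t 1 * p + t 4 * q := ⟨_, rfl⟩
  have hω : p * w₂ - q * w₁ = -1 := by rw [hw₁, hw₂]; linear_combination hpq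
  have hN₁ : t 3 * w₂ - t 4 * w₁ = 0 := by rw [hw₁, hw₂]; linear_combination p * hq
  have hN₂ : t 1 * w₁ + t 4 * w₂ = 0 := by rw [hw₁, hw₂]; linear_combination q * hq
  -- `f₁ + w` and `f₁ - w` are eigenvectors; adding half of the former to the latter produces the
  -- coefficient `1` of `ψ₁²³` in `d(1 : -1)`
  refine equivalent_of_basis ![![1, w₁, w₂], ![3 / 2, -w₁ / 2, -w₂ / 2], ![0, p, q]] ?_ ?_ ?_ ?_
  · rw [isUnit_iff_ne_zero, Matrix.det_fin_three]
    have : -(w₁ / 2 * q) + w₂ / 2 * p - (3 / 2) * (w₁ * q) + (3 / 2) * (w₂ * p) = -2 := by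
      linear_combination 2 * hω
    simp
    intro h
    have h2 : (-2 : ℂ) = 0 := by linear_combination h - this
    norm_num at h2
  all_goals
    funext j
    rw [dInf_apply]
    fin_cases j <;> simp [dFam, coeff_psi, h₀, h₂]
  · ring
  · linear_combination -2 * hN₁
  · linear_combination -2 * hN₂
  · linear_combination -hω
  · linear_combination -hw₁
  · linear_combination -hw₂
  · linear_combination hω / 2
  · linear_combination -3 / 2 * hw₁
  · linear_combination -3 / 2 * hw₂

end Equivalences

/-! ### The solution set of the relations -/

section Sol

theorem isCodifferential_dInf_iff_mem_sol (t : Fin 5 → ℂ) :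
    IsCodifferential (dInf t) ↔ t ∈ Sol :=
  isCodifferential_dInf_iff t

theorem sol_eq_union : Sol = Sol₁ ∪ Sol₂ ∪ Sol₃ := by
  ext t
  constructor
  · rintro ⟨h, h'⟩
    rcases eq_or_ne (t 2) 0 with h₂ | h₂
    · left
      rw [h₂, zero_mul, add_zero] at h
      rw [h₂, mul_zero, sub_zero] at h'
      rcases eq_or_ne (t 0) 0 with h₀ | h₀
      · exact Or.inl ⟨h₀, h₂⟩
      · exact Or.inr ⟨h₂, (mul_eq_zero.1 h).resolve_left h₀, (mul_eq_zero.1 h').resolve_left h₀⟩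
    · refine Or.inr ⟨h₂, ?_, ?_⟩
      · rw [eq_div_iff h₂]
        linear_combination h
      · rw [eq_div_iff (pow_ne_zero 2 h₂)]
        linear_combination t 0 * h - t 2 * h'
  · rintro ((⟨h₀, h₂⟩ | ⟨h₂, h₃, h₄⟩) | ⟨h₂, h₄, h₁⟩)
    · simp [Sol, h₀, h₂]
    · simp [Sol, h₂, h₃, h₄]
    · constructor
      · rw [h₄]; field_simp; ring
      · rw [h₄, h₁]; field_simp; ring

theorem sol₁_subset_sol : Sol₁ ⊆ Sol := by
  rw [sol_eq_union]
  exact Set.subset_union_left.trans Set.subset_union_left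

theorem sol₂_subset_sol : Sol₂ ⊆ Sol := by
  rw [sol_eq_union]
  exact Set.subset_union_right.trans Set.subset_union_left

theorem sol₃_subset_sol : Sol₃ ⊆ Sol := by
  rw [sol_eq_union]
  exact Set.subset_union_right

end Sol

/-! ### Jump deformations along weighted curves -/

section Jumps

/-- A weighted homogeneous curve `s ↦ (s^{n_i} tⁱ)` with positive weights that stays in one piece of
the solution set and in one isomorphism class yields a jump deformation. -/
theorem jumpsThrough_of_weights {S : Set (Fin 5 → ℂ)} (hS : S ⊆ Sol) {t : Fin 5 → ℂ}
    {d' : Cochain ℂ 2} (n : Fin 5 → ℕ) (hn : ∀ i, n i ≠ 0)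
    (h : ∀ s : ℂ, s ≠ 0 → (fun i => t i * s ^ n i) ∈ S ∧
      Equivalent (dInf fun i => t i * s ^ n i) d')
    (hd' : ¬ Equivalent (d1 ℂ) d') : JumpsThrough S t d' := by
  have hc : ∀ s : ℂ, (fun i => (Polynomial.C (t i) * Polynomial.X ^ n i).eval s)
      = fun i => t i * s ^ n i := fun s => by
    funext i
    simp
  have h₀ : (fun i => t i * (0 : ℂ) ^ n i) = 0 := by
    funext i
    simp [hn i]
  refine ⟨fun i => Polynomial.C (t i) * Polynomial.X ^ n i, fun i => by simp [hn i],
    fun i => by simp, fun s hs => by simpa only [hc] using h s hs, ?_, ?_, ?_, ?_, hd'⟩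
  · refine Filter.Eventually.of_forall fun s => ?_
    simp only [hc, isCodifferential_dInf_iff_mem_sol]
    rcases eq_or_ne s 0 with rfl | hs
    · rw [h₀]
      simp [Sol]
    · exact hS (h s hs).1
  · intro i j k
    simp only [hc, coeff_dInf]
    fun_prop
  · simp only [hc, h₀, d1_eq_dInf]
  · filter_upwards [self_mem_nhdsWithin] with s hs
    simpa only [hc] using (h s hs).2

theorem jumpsThrough_sol₁_d3 {t : Fin 5 → ℂ} (ht : t ∈ Sol₁) (hq : t 1 * t 3 + t 4 ^ 2 ≠ 0) :
    JumpsThrough Sol₁ t d3 := by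
  refine jumpsThrough_of_weights sol₁_subset_sol (fun _ => 1) (fun _ => one_ne_zero)
    (fun s hs => ?_) not_equivalent_d1_d3
  have hmem : (fun i => t i * s ^ 1) ∈ Sol₁ := by simp [Sol₁, ht.1, ht.2]
  refine ⟨hmem, equivalent_d3_of_mem_sol₁ hmem fun h => hq ?_⟩
  exact (mul_eq_zero.1 (by linear_combination h :
    s ^ 2 * (t 1 * t 3 + t 4 ^ 2) = 0)).resolve_left (pow_ne_zero 2 hs)

theorem jumpsThrough_sol₁_dFam {t : Fin 5 → ℂ} (ht : t ∈ Sol₁) (hq : t 1 * t 3 + t 4 ^ 2 = 0)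
    (hne : t ≠ 0) : JumpsThrough Sol₁ t (dFam 1 (-1)) := by
  refine jumpsThrough_of_weights sol₁_subset_sol (fun _ => 1) (fun _ => one_ne_zero)
    (fun s hs => ?_) (not_equivalent_d1_dFam (Or.inl one_ne_zero))
  have hmem : (fun i => t i * s ^ 1) ∈ Sol₁ := by simp [Sol₁, ht.1, ht.2]
  refine ⟨hmem, equivalent_dFam_of_mem_sol₁ hmem (by linear_combination s ^ 2 * hq) fun h =>
    hne (funext fun i => ?_)⟩
  simpa [hs] using congrFun h i

theorem jumpsThrough_sol₂ {t : Fin 5 → ℂ} (ht : t ∈ Sol₂) {α β : ℂ} (hαβ : α ≠ 0 ∨ β ≠ 0)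
    (h₀ : t 0 = α + β) (h₁ : t 1 = α * β) : JumpsThrough Sol₂ t (dFam α β) := by
  refine jumpsThrough_of_weights sol₂_subset_sol ![1, 2, 1, 1, 1]
    (fun i => by fin_cases i <;> simp) (fun s hs => ?_) (not_equivalent_d1_dFam hαβ)
  have hmem : (fun i => t i * s ^ (![1, 2, 1, 1, 1] : Fin 5 → ℕ) i) ∈ Sol₂ := by
    simp [Sol₂, ht.1, ht.2.1, ht.2.2]
  refine ⟨hmem, (equivalent_dFam_of_mem_sol₂ hmem (α := s * α) (β := s * β) ?_ ?_).trans
    (equivalent_dFam_smul hs α β)⟩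
  · simp [h₀]; ring
  · simp [h₁]; ring

theorem jumpsThrough_sol₃ {t : Fin 5 → ℂ} (ht : t ∈ Sol₃) {α β : ℂ}
    (h₂ : t 2 = α + β) (h₃ : t 3 = -(α * β)) : JumpsThrough Sol₃ t (dFam α β) := by
  have hαβ : α ≠ 0 ∨ β ≠ 0 := by
    by_contra! H
    exact ht.1 (by rw [h₂, H.1, H.2, add_zero])
  refine jumpsThrough_of_weights sol₃_subset_sol ![1, 2, 1, 2, 2]
    (fun i => by fin_cases i <;> simp) (fun s hs => ?_) (not_equivalent_d1_dFam hαβ)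
  have hmem : (fun i => t i * s ^ (![1, 2, 1, 2, 2] : Fin 5 → ℕ) i) ∈ Sol₃ := by
    obtain ⟨hne, h₄, h₁⟩ := ht
    refine ⟨by simp [hne, hs], ?_, ?_⟩
    · simp [h₄]; field_simp
    · simp [h₁]; field_simp
  refine ⟨hmem, (equivalent_dFam_of_mem_sol₃ hmem (α := s * α) (β := s * β) ?_ ?_).trans
    (equivalent_dFam_smul hs α β)⟩
  · simp [h₂]; ring
  · simp [h₃]; ring

theorem JumpsThrough.jumpsTo {S : Set (Fin 5 → ℂ)} {t : Fin 5 → ℂ} {d' : Cochain ℂ 2}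
    (h : JumpsThrough S t d') : JumpsTo (d1 ℂ) d' := by
  obtain ⟨c, -, -, -, hc⟩ := h
  exact ⟨_, hc⟩

/-- The endpoint `c(1) = t` of the curve belongs to the class that is jumped to. -/
theorem JumpsThrough.equivalent {S : Set (Fin 5 → ℂ)} {t : Fin 5 → ℂ} {d' : Cochain ℂ 2}
    (h : JumpsThrough S t d') : Equivalent (dInf t) d' := by
  obtain ⟨c, -, h₁, hc, -⟩ := h
  have h' := (hc 1 one_ne_zero).2
  simpa only [h₁] using h'

theorem JumpsTo.of_equivalent {d d' d'' : Cochain ℂ 2} (h : JumpsTo d d')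
    (h' : Equivalent d' d'') : JumpsTo d d'' := by
  obtain ⟨D, h₁, h₂, h₃, h₄, h₅⟩ := h
  exact ⟨D, h₁, h₂, h₃, h₄.mono fun s hs => hs.trans h', fun h => h₅ (h.trans h'.symm)⟩

theorem jumpsTo_d3 : JumpsTo (d1 ℂ) d3 :=
  (jumpsThrough_sol₁_d3 (t := ![0, 0, 0, 0, 1]) (by simp [Sol₁]) (by simp)).jumpsTo

theorem jumpsTo_dFam {α β : ℂ} (hαβ : α ≠ 0 ∨ β ≠ 0) : JumpsTo (d1 ℂ) (dFam α β) :=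
  (jumpsThrough_sol₂ (t := ![α + β, α * β, 0, 0, 0]) (by simp [Sol₂]) hαβ rfl rfl).jumpsTo

theorem exists_add_mul_eq (a b : ℂ) : ∃ α β : ℂ, a = α + β ∧ b = α * β := by
  obtain ⟨r, hr⟩ := IsAlgClosed.exists_pow_nat_eq (a ^ 2 - 4 * b) two_pos
  exact ⟨(a + r) / 2, (a - r) / 2, by ring, by linear_combination hr / 4⟩

/-- Every Lie algebra structure in the family `d^∞` other than `d₁` itself is the end of a jump
deformation from `d₁`. -/
theorem jumpsTo_dInf {t : Fin 5 → ℂ} (ht : t ∈ Sol) (hne : t ≠ 0) : JumpsTo (d1 ℂ) (dInf t) := by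
  suffices ∃ S d', JumpsThrough S t d' by
    obtain ⟨S, d', h⟩ := this
    exact h.jumpsTo.of_equivalent h.equivalent.symm
  rw [sol_eq_union] at ht
  rcases ht with (ht | ht) | ht
  · by_cases hq : t 1 * t 3 + t 4 ^ 2 = 0
    · exact ⟨_, _, jumpsThrough_sol₁_dFam ht hq hne⟩
    · exact ⟨_, _, jumpsThrough_sol₁_d3 ht hq⟩
  · obtain ⟨α, β, h₀, h₁⟩ := exists_add_mul_eq (t 0) (t 1)
    refine ⟨_, _, jumpsThrough_sol₂ ht (α := α) (β := β) ?_ h₀ h₁⟩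
    by_contra! H
    refine hne (funext fun i => ?_)
    fin_cases i <;> simp [h₀, h₁, H, ht.1, ht.2.1, ht.2.2]
  · obtain ⟨α, β, h₂, h₃⟩ := exists_add_mul_eq (t 2) (-t 3)
    exact ⟨_, _, jumpsThrough_sol₃ ht h₂ (by linear_combination -h₃)⟩

end Jumps

/-! ### The points of the moduli space reached from the Heisenberg algebra -/

section ModuliSpace

/-- If `d(a, b) = l(b) a - l(a) b`, then a basis whose first two vectors lie in `ker l` and whose
third vector has `l = 1` exhibits `d` as `d₂`. -/
theorem equivalent_d2_of_basis {d : Cochain ℂ 2} {l : Vec ℂ → ℂ}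
    (hl : ∀ a b, d ![a, b] = l b • a - l a • b) (v : Fin 3 → Vec ℂ)
    (hv : (Matrix.of v).det ≠ 0) (h₀ : l (v 0) = 0) (h₁ : l (v 1) = 0) (h₂ : l (v 2) = 1) :
    Equivalent d2 d := by
  refine (equivalent_of_basis v (isUnit_iff_ne_zero.2 hv) ?_ ?_ ?_).symm <;>
    rw [hl] <;> simp [d2, coeff_psi, h₀, h₁, h₂]

/-- A structure in which `d(a, b)` always lies in the plane spanned by `a` and `b` has the form
`d(a, b) = l(b) a - l(a) b` for a linear form `l`. -/
theorem exists_form_of_det_eq_zero {d : Cochain ℂ 2}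
    (h : ∀ a b, (Matrix.of ![d ![a, b], a, b]).det = 0) :
    ∃ l₀ l₁ l₂ : ℂ, ∀ a b : Vec ℂ, d ![a, b] = (l₀ * b 0 + l₁ * b 1 + l₂ * b 2) • a
      - (l₀ * a 0 + l₁ * a 1 + l₂ * a 2) • b := by
  have key : ∀ a b : Vec ℂ, d ![a, b] 0 * (a 1 * b 2 - a 2 * b 1)
      - d ![a, b] 1 * (a 0 * b 2 - a 2 * b 0) + d ![a, b] 2 * (a 0 * b 1 - a 1 * b 0) = 0 := by
    intro a b
    have := h a b
    simp [Matrix.det_fin_three] at this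
    linear_combination this
  simp only [cochain_apply_coord] at key
  -- pairs of basis vectors kill three coefficients; the sums of two basis vectors give three
  -- relations between the others
  have h₁ := key ![1, 0, 0] ![0, 1, 0]
  have h₂ := key ![1, 0, 0] ![0, 0, 1]
  have h₃ := key ![0, 1, 0] ![0, 0, 1]
  have h₄ := key ![1, 1, 0] ![0, 0, 1]
  have h₅ := key ![1, 0, 0] ![0, 1, 1]
  have h₆ := key ![1, 0, 1] ![0, 1, 0]
  simp at h₁ h₂ h₃ h₄ h₅ h₆
  have h₄' : coeff d 1 2 1 = coeff d 0 2 0 := by linear_combination -h₄ + h₃ - h₂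
  have h₅' : coeff d 0 2 2 = coeff d 0 1 1 := by linear_combination h₅ + h₂ - h₁
  have h₆' : coeff d 1 2 2 = -coeff d 0 1 0 := by linear_combination -h₆ + h₃ + h₁
  refine ⟨-coeff d 0 1 1, coeff d 0 1 0, coeff d 0 2 0, fun a b => funext fun k => ?_⟩
  rw [cochain_apply_coord]
  fin_cases k <;> simp [h₁, h₂, h₃, h₄', h₅', h₆'] <;> ring

/-- A nonzero structure that is not isomorphic to `d₂` has a basis of the form `d(a, b), a, b`. -/
theorem exists_det_ne_zero {d : Cochain ℂ 2} (hd : d ≠ 0) (hd₂ : ¬ Equivalent d2 d) :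
    ∃ a b, (Matrix.of ![d ![a, b], a, b]).det ≠ 0 := by
  by_contra! H
  obtain ⟨l₀, l₁, l₂, hl⟩ := exists_form_of_det_eq_zero H
  have hb := fun v => equivalent_d2_of_basis
    (l := fun a : Vec ℂ => l₀ * a 0 + l₁ * a 1 + l₂ * a 2) hl v
  by_cases h₀ : l₀ = 0
  · by_cases h₁ : l₁ = 0
    · by_cases h₂ : l₂ = 0
      · refine hd (cochain_ext (fun k => ?_) (fun k => ?_) (fun k => ?_)) <;>
          simp [coeff, hl, h₀, h₁, h₂]
      · exact hd₂ (hb ![![1, 0, 0], ![0, 1, 0], ![0, 0, l₂⁻¹]]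
          (by simp [Matrix.det_fin_three, h₂]) (by simp [h₀]) (by simp [h₁]) (by simp [h₂]))
    · exact hd₂ (hb ![![1, 0, 0], ![0, -l₂, l₁], ![0, l₁⁻¹, 0]]
        (by simp [Matrix.det_fin_three, h₁]) (by simp [h₀]) (by simp; ring) (by simp [h₁]))
  · exact hd₂ (hb ![![-l₁, l₀, 0], ![-l₂, 0, l₀], ![l₀⁻¹, 0, 0]]
      (by simp [Matrix.det_fin_three, h₀]) (by simp; ring) (by simp; ring) (by simp [h₀]))

/-- The coefficient of `ψ₁²³` is `1` for `d₁` and depends continuously on the structure, hence a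
class on which it vanishes is not reached by a jump deformation from `d₁`. -/
theorem not_jumpsTo_of_coeff_eq_zero {d' : Cochain ℂ 2}
    (h : ∀ d, Equivalent d d' → coeff d 1 2 0 = 0) : ¬ JumpsTo (d1 ℂ) d' := by
  rintro ⟨D, -, hD, hD₀, hDs, -⟩
  have h₁ : Filter.Tendsto (fun s => coeff (D s) 1 2 0) (nhdsWithin 0 {0}ᶜ) (nhds 1) := by
    have := (hD 1 2 0).continuousAt.tendsto
    rw [hD₀, coeff_d1_one_two_zero] at this
    exact this.mono_left nhdsWithin_le_nhds
  have h₂ : Filter.Tendsto (fun s => coeff (D s) 1 2 0) (nhdsWithin 0 {0}ᶜ) (nhds 0) :=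
    tendsto_const_nhds.congr' (hDs.mono fun s hs => (h _ hs).symm)
  exact one_ne_zero (tendsto_nhds_unique h₁ h₂)

theorem not_jumpsTo_zero : ¬ JumpsTo (d1 ℂ) 0 := by
  refine not_jumpsTo_of_coeff_eq_zero fun d h => ?_
  obtain ⟨g, rfl⟩ := h.symm
  rw [coeff, pull_apply]
  simp

theorem not_jumpsTo_d2 : ¬ JumpsTo (d1 ℂ) d2 := by
  refine not_jumpsTo_of_coeff_eq_zero fun d h => ?_
  obtain ⟨g, rfl⟩ := h.symm
  rw [coeff, pull_apply, d2_apply, map_sub, map_smul, map_smul, g.symm_apply_apply,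
    g.symm_apply_apply]
  simp

theorem jumpsTo_d1_iff {d' : Cochain ℂ 2} (hd' : IsCodifferential d') :
    JumpsTo (d1 ℂ) d' ↔ d' ≠ 0 ∧ ¬ Equivalent (d1 ℂ) d' ∧ ¬ Equivalent d2 d' := by
  constructor
  · intro h
    refine ⟨?_, ?_, fun h' => not_jumpsTo_d2 (h.of_equivalent h'.symm)⟩
    · rintro rfl
      exact not_jumpsTo_zero h
    · obtain ⟨D, -, -, -, -, hne⟩ := h
      exact hne
  · rintro ⟨h₀, h₁, h₂⟩
    obtain ⟨a, b, hab⟩ := exists_det_ne_zero h₀ h₂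
    obtain ⟨g, t, -, -, -, hg⟩ := exists_pull_eq_dInf hd' a b (isUnit_iff_ne_zero.2 hab)
    have ht : t ∈ Sol := by
      rw [← isCodifferential_dInf_iff_mem_sol, ← hg]
      exact hd'.pull g
    have h : Equivalent (dInf t) d' := Equivalent.symm ⟨g, hg⟩
    refine (jumpsTo_dInf ht ?_).of_equivalent h
    rintro rfl
    exact h₁ (d1_eq_dInf (B := ℂ) ▸ h)

end ModuliSpace

/-! ### The second cohomology of the Heisenberg algebra -/

section Cohomology

variable {B : Type u} [CommRing B]

theorem D₁_apply (d : Cochain B 2) (φ : Vec B →ₗ[B] Vec B) (a b : Vec B) :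
    D₁ d φ ![a, b] = d ![φ a, b] + d ![a, φ b] - φ (d ![a, b]) := rfl

/-- The two-cocycles of `d₁` form the hyperplane on which the coefficients of `ψ₂¹²` and `ψ₃¹³` are
opposite. -/
theorem mem_ker_D₂_d1_iff (ψ : Cochain B 2) :
    ψ ∈ LinearMap.ker (D₂ (d1 B)) ↔ coeff ψ 0 1 1 + coeff ψ 0 2 2 = 0 := by
  have h : D₂ (d1 B) ψ ![basisVec B 0, basisVec B 1, basisVec B 2]
      = (coeff ψ 0 1 1 + coeff ψ 0 2 2) • basisVec B 0 := by
    change comp (d1 B) ψ ![_, _, _] + comp ψ (d1 B) ![_, _, _] = _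
    rw [comp_apply, comp_apply]
    simp only [d1_eq_dInf, dInf_apply (B := B) 0]
    funext k
    simp only [Pi.add_apply, Pi.sub_apply, cochain_apply_coord]
    fin_cases k <;> simp [basisVec, coeff]
  rw [LinearMap.mem_ker]
  constructor
  · intro h'
    rw [h'] at h
    simpa [basisVec] using (congrFun h 0).symm
  · intro h'
    rw [h', zero_smul] at h
    exact cochain₃_eq_zero h

/-- The two-coboundaries of `d₁`. -/
theorem mem_range_D₁_d1_iff (ψ : Cochain B 2) :
    ψ ∈ LinearMap.range (D₁ (d1 B)) ↔ coeff ψ 0 1 1 = 0 ∧ coeff ψ 0 1 2 = 0 ∧ coeff ψ 0 2 1 = 0 ∧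
      coeff ψ 0 2 2 = 0 ∧ coeff ψ 0 1 0 = coeff ψ 1 2 2 ∧ coeff ψ 0 2 0 = -coeff ψ 1 2 1 := by
  constructor
  · rintro ⟨φ, rfl⟩
    have hz : (![0, 0, 0] : Vec B) = 0 := by
      funext i
      fin_cases i <;> rfl
    have he : (![1, 0, 0] : Vec B) = Pi.single 0 1 := by
      funext i
      fin_cases i <;> simp
    simp only [coeff, D₁_apply, d1_eq_dInf, dInf_apply (B := B) 0]
    simp [hz, he]
  · rintro ⟨h₁, h₂, h₃, h₄, h₅, h₆⟩
    refine ⟨Matrix.toLin' !![-coeff ψ 1 2 0, 0, 0; -coeff ψ 1 2 1, 0, 0; -coeff ψ 1 2 2, 0, 0],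
      cochain_ext (fun k => ?_) (fun k => ?_) (fun k => ?_)⟩ <;>
      rw [coeff, D₁_apply, d1_eq_dInf, dInf_apply, dInf_apply, dInf_apply] <;>
      fin_cases k <;> simp [h₁, h₂, h₃, h₄, h₅, h₆, Matrix.vecHead, Matrix.vecTail]

theorem coeff_sum_delta (c : Fin 5 → B) (i j k : Fin 3) :
    coeff (∑ l, c l • delta B l) i j k = c 0 * coeff (psi B 0 1 0) i j k
      + c 1 * coeff (psi B 0 1 2) i j k + c 2 * coeff (psi B 0 2 0) i j k
      + c 3 * coeff (psi B 0 2 1) i j k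
      + c 4 * (coeff (psi B 0 2 2) i j k - coeff (psi B 0 1 1) i j k) := by
  simp [delta, Fin.sum_univ_five]

theorem isPrebasisH2_delta : IsPrebasisH2 (d1 B) (delta B) := by
  constructor
  · intro i
    rw [mem_ker_D₂_d1_iff]
    fin_cases i <;> simp [delta, coeff_psi]
  · intro ψ hψ
    rw [mem_ker_D₂_d1_iff] at hψ
    simp only [mem_range_D₁_d1_iff, coeff_sub, coeff_sum_delta]
    simp only [coeff_psi, Pi.single_apply, Fin.reduceEq, if_true, if_false]
    refine ⟨![coeff ψ 0 1 0 - coeff ψ 1 2 2, coeff ψ 0 1 2, coeff ψ 0 2 0 + coeff ψ 1 2 1,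
      coeff ψ 0 2 1, coeff ψ 0 2 2], ?_, ?_⟩
    · simp [hψ]
    · rintro c ⟨-, h₂, h₃, h₄, h₅, h₆⟩
      funext i
      fin_cases i <;> simp at h₂ h₃ h₄ h₅ h₆ ⊢
      · linear_combination -h₅
      · linear_combination -h₂
      · linear_combination -h₆
      · linear_combination -h₃
      · linear_combination -h₄

end Cohomology

/-! ### Change of base -/

section Push

variable {B : Type u} [CommRing B] {C : Type v} [CommRing C]

theorem coeff_push_zero_one (f : B →+* C) (d : Cochain B 2) (k : Fin 3) :
    coeff (push f d) 0 1 k = f (coeff d 0 1 k) := by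
  fin_cases k <;> simp [push, Fin.sum_univ_three, coeff_psi]

theorem coeff_push_zero_two (f : B →+* C) (d : Cochain B 2) (k : Fin 3) :
    coeff (push f d) 0 2 k = f (coeff d 0 2 k) := by
  fin_cases k <;> simp [push, Fin.sum_univ_three, coeff_psi]

theorem coeff_push_one_two (f : B →+* C) (d : Cochain B 2) (k : Fin 3) :
    coeff (push f d) 1 2 k = f (coeff d 1 2 k) := by
  fin_cases k <;> simp [push, Fin.sum_univ_three, coeff_psi]

theorem push_apply (f : B →+* C) (d : Cochain B 2) (a b : Vec B) :
    push f d ![f ∘ a, f ∘ b] = f ∘ d ![a, b] := by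
  funext k
  simp only [Function.comp, cochain_apply_coord, coeff_push_zero_one, coeff_push_zero_two,
    coeff_push_one_two, map_add, map_mul, map_sub]

theorem push_dInf (f : B →+* C) (t : Fin 5 → B) : push f (dInf t) = dInf (f ∘ t) := by
  refine cochain_ext (fun k => ?_) (fun k => ?_) (fun k => ?_)
  · rw [coeff_push_zero_one, congrFun (coeff_dInf_zero_one _) k,
      congrFun (coeff_dInf_zero_one _) k]
    fin_cases k <;> simp
  · rw [coeff_push_zero_two, congrFun (coeff_dInf_zero_two _) k,
      congrFun (coeff_dInf_zero_two _) k]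
    fin_cases k <;> simp
  · rw [coeff_push_one_two, congrFun (coeff_dInf_one_two _) k,
      congrFun (coeff_dInf_one_two _) k]
    fin_cases k <;> simp

theorem eq_zero_of_dInf_eq_d1 {t : Fin 5 → B} (h : dInf t = d1 B) : t = 0 := by
  have h₁ := coeff_dInf_zero_one t
  have h₂ := coeff_dInf_zero_two t
  rw [h, d1_eq_dInf, coeff_dInf_zero_one] at h₁
  rw [h, d1_eq_dInf, coeff_dInf_zero_two] at h₂
  funext i
  fin_cases i
  · simpa using (congrFun h₁ 0).symm
  · simpa using (congrFun h₁ 2).symm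
  · simpa using (congrFun h₂ 0).symm
  · simpa using (congrFun h₂ 1).symm
  · simpa using (congrFun h₂ 2).symm

end Push

/-! ### Deformations of the Heisenberg algebra over local bases -/

section NormalForm

variable {B : Type u} [CommRing B] [Algebra ℂ B] {ε : B →ₐ[ℂ] ℂ}

theorem comp_linearEquiv_apply {g : Vec B ≃ₗ[B] Vec B}
    (hg : ∀ i j, ε (g (Pi.single j 1) i) = (1 : Matrix (Fin 3) (Fin 3) ℂ) i j) (a : Vec B) :
    ε ∘ g a = ε ∘ a := by
  funext i
  simp only [Function.comp, linearEquiv_apply g a, Pi.add_apply, Pi.smul_apply, smul_eq_mul,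
    map_add, map_mul, hg, Matrix.one_apply]
  fin_cases i <;> simp

theorem comp_linearEquiv_symm_apply {g : Vec B ≃ₗ[B] Vec B}
    (hg : ∀ i j, ε (g (Pi.single j 1) i) = (1 : Matrix (Fin 3) (Fin 3) ℂ) i j) (a : Vec B) :
    ε ∘ g.symm a = ε ∘ a := by
  rw [← comp_linearEquiv_apply hg, g.apply_symm_apply]

theorem InfEquivalent.symm {d d' : Cochain B 2} (h : InfEquivalent ε d d') :
    InfEquivalent ε d' d := by
  obtain ⟨g, hg, hd⟩ := h
  refine ⟨g.symm, fun i j => ?_, pull_eq_symm hd⟩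
  refine (congrFun (comp_linearEquiv_symm_apply hg _) i).trans ?_
  simp [Pi.single_apply, Matrix.one_apply, apply_ite ε]

/-- Equivalent deformations have the same reduction. -/
theorem InfEquivalent.push_eq {d d' : Cochain B 2} (h : InfEquivalent ε d d') :
    push (ε : B →+* ℂ) d = push (ε : B →+* ℂ) d' := by
  obtain ⟨g, hg, hd⟩ := h
  rw [pull_eq_iff] at hd
  have key : ∀ i j k, ε (coeff d i j k) = ε (coeff d' i j k) := by
    intro i j k
    have h₁ : ε ∘ d ![g (basisVec B i), g (basisVec B j)]
        = ε ∘ d ![basisVec B i, basisVec B j] := by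
      refine (push_apply (ε : B →+* ℂ) d _ _).symm.trans ?_
      refine Eq.trans ?_ (push_apply (ε : B →+* ℂ) d _ _)
      exact congrArg₂ (fun a b => push (ε : B →+* ℂ) d ![a, b]) (comp_linearEquiv_apply hg _)
        (comp_linearEquiv_apply hg _)
    rw [hd, comp_linearEquiv_apply hg] at h₁
    exact (congrFun h₁ k).symm
  refine cochain_ext (fun k => ?_) (fun k => ?_) (fun k => ?_)
  · rw [coeff_push_zero_one, coeff_push_zero_one]; exact key _ _ _
  · rw [coeff_push_zero_two, coeff_push_zero_two]; exact key _ _ _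
  · rw [coeff_push_one_two, coeff_push_one_two]; exact key _ _ _

/-- Over a local base, every deformation of `d₁` is equivalent to a member of the family `d^∞`: the
vectors `d(f₂, f₃), f₂, f₃` reduce to the standard basis of `V`, hence form a basis. -/
theorem IsDeformation.exists_infEquivalent_dInf [IsLocalRing B] {dB : Cochain B 2}
    (h : IsDeformation ε (d1 ℂ) dB) : ∃ t : Fin 5 → B, (∀ i, ε (t i) = 0) ∧
      t 0 * t 3 + t 2 * t 4 = 0 ∧ t 0 * t 4 - t 1 * t 2 = 0 ∧ InfEquivalent ε (dInf t) dB := by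
  obtain ⟨hd, hε⟩ := h
  have hcoeff : ∀ k, ε (dB ![basisVec B 1, basisVec B 2] k) = basisVec ℂ 0 k := by
    intro k
    have h' := coeff_push_one_two (ε : B →+* ℂ) dB k
    rw [hε, d1_eq_dInf, congrFun (coeff_dInf_one_two _) k] at h'
    refine h'.symm.trans ?_
    fin_cases k <;> simp [basisVec]
  -- this determinant is the `f₁`-coordinate of `d(f₂, f₃)`, which reduces to `1`
  have hdet : IsUnit (Matrix.of
      ![dB ![basisVec B 1, basisVec B 2], basisVec B 1, basisVec B 2]).det := by
    have h₀ := hcoeff 0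
    rw [Matrix.det_fin_three]
    simp [basisVec] at h₀ ⊢
    by_contra hu
    have hker : RingHom.ker ε = IsLocalRing.maximalIdeal B :=
      IsLocalRing.eq_maximalIdeal (RingHom.ker_isMaximal_of_surjective ε fun z =>
        ⟨algebraMap ℂ B z, ε.commutes z⟩)
    have h₁ : dB ![Pi.single 1 1, Pi.single 2 1] 0 ∈ RingHom.ker ε := by
      rw [hker]
      exact hu
    rw [RingHom.mem_ker, h₀] at h₁
    exact one_ne_zero h₁
  obtain ⟨g, t, hg₀, hg₁, hg₂, hg⟩ := exists_pull_eq_dInf hd _ _ hdet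
  have hinf : InfEquivalent ε dB (dInf t) := by
    refine ⟨g, fun i j => ?_, hg⟩
    fin_cases j
    · refine (congrArg (fun a : Vec B => ε (a i)) hg₀).trans ((hcoeff i).trans ?_)
      fin_cases i <;> simp [basisVec]
    · refine (congrArg (fun a : Vec B => ε (a i)) hg₁).trans ?_
      fin_cases i <;> simp [basisVec]
    · refine (congrArg (fun a : Vec B => ε (a i)) hg₂).trans ?_
      fin_cases i <;> simp [basisVec]
  have hrel := (isCodifferential_dInf_iff t).1 (hg ▸ hd.pull g)
  refine ⟨t, fun i => ?_, hrel.1, hrel.2, hinf.symm⟩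
  have h' := hinf.push_eq
  rw [hε, push_dInf] at h'
  exact congrFun (eq_zero_of_dInf_eq_d1 h'.symm) i

/-- Over an infinitesimal base the parameters of the family `d^∞` are determined by the equivalence
class of the deformation. To first order the coefficient `ψ₁¹²` changes by the `f₃`-component of
`g f₁ - f₁` and `ψ₁¹³` by its `f₂`-component, and both vanish because
`d(f₂, f₃) = f₁` is preserved. -/
theorem InfEquivalent.eq_of_ker_sq_eq_bot (hε : RingHom.ker ε ^ 2 = ⊥) {t t' : Fin 5 → B}
    (ht : ∀ i, ε (t i) = 0) (ht' : ∀ i, ε (t' i) = 0)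
    (h : InfEquivalent ε (dInf t) (dInf t')) : t = t' := by
  have hmul : ∀ {x y : B}, ε x = 0 → ε y = 0 → x * y = 0 := by
    intro x y hx hy
    have : x * y ∈ RingHom.ker ε ^ 2 := by
      rw [pow_two]
      exact Ideal.mul_mem_mul hx hy
    rwa [hε] at this
  obtain ⟨g, hg, hd⟩ := h
  rw [pull_eq_iff] at hd
  -- write `g = 1 + G`; every product of two entries of `G`, `t`, `t'` vanishes
  obtain ⟨G, hG⟩ : ∃ G : Fin 3 → Vec B, ∀ j, g (basisVec B j) = basisVec B j + G j :=
    ⟨fun j => g (basisVec B j) - basisVec B j, fun j => by rw [add_sub_cancel]⟩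
  have hGε : ∀ i j, ε (G j i) = 0 := by
    intro i j
    have h' := hg i j
    change ε (g (basisVec B j) i) = _ at h'
    rw [hG, Pi.add_apply, map_add] at h'
    simpa [basisVec, Pi.single_apply, Matrix.one_apply, apply_ite ε] using h'
  have hGG : ∀ i j i' j', G j i * G j' i' = 0 := fun i j i' j' => hmul (hGε i j) (hGε i' j')
  have hGt : ∀ i j k, G j i * t k = 0 := fun i j k => hmul (hGε i j) (ht k)
  have htG : ∀ i j k, t' k * G j i = 0 := fun i j k => hmul (ht' k) (hGε i j)
  have h₀₁ := hd (basisVec B 0) (basisVec B 1)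
  have h₀₂ := hd (basisVec B 0) (basisVec B 2)
  have h₁₂ := hd (basisVec B 1) (basisVec B 2)
  rw [dInf_basisVec_zero_one, linearEquiv_apply g ![_, _, _]] at h₀₁
  rw [dInf_basisVec_zero_two, linearEquiv_apply g ![_, _, _]] at h₀₂
  rw [dInf_basisVec_one_two] at h₁₂
  simp only [hG, dInf_apply] at h₀₁ h₀₂ h₁₂
  -- `e₁`, `e₂` give the vanishing of the `f₂`- and `f₃`-components of `G f₁`
  have e₁ := congrFun h₁₂ 1
  have e₂ := congrFun h₁₂ 2
  have x₀ := congrFun h₀₁ 0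
  have x₂ := congrFun h₀₁ 2
  have y₀ := congrFun h₀₂ 0
  have y₁ := congrFun h₀₂ 1
  have y₂ := congrFun h₀₂ 2
  simp [basisVec, add_mul, mul_add, hGG, hGt, htG] at e₁ e₂ x₀ x₂ y₀ y₁ y₂
  funext i
  fin_cases i
  · simpa [← e₂] using x₀
  · simpa using x₂
  · simpa [← e₁] using y₀
  · simpa using y₁
  · simpa using y₂

end NormalForm

/-! ### Formal bases and the universal properties -/

section Formal

open MvPolynomial in
/-- The power series without constant term form the ideal generated by the variables. -/
theorem mvPowerSeries_ker_constantCoeff (σ R : Type*) [Finite σ] [CommRing R] :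
    RingHom.ker (MvPowerSeries.constantCoeff : MvPowerSeries σ R →+* R)
      = Ideal.span (Set.range MvPowerSeries.X) := by
  refine le_antisymm (fun p hp => ?_) (Ideal.span_le.2 ?_)
  · have hmem : MvPowerSeries.toAdicCompletionAlgEquiv σ R p
        ∈ (AdicCompletion.eval (idealOfVars σ R) (MvPolynomial σ R) 1).ker := by
      rw [LinearMap.mem_ker, AdicCompletion.eval_apply,
        MvPowerSeries.toAdicCompletionAlgEquiv_apply,
        MvPowerSeries.toAdicCompletion_apply_eq_mk_truncTotal]
      refine Ideal.Quotient.eq_zero_iff_mem.2 ?_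
      have h0 : MvPowerSeries.truncTotal 1 p = 0 := by
        ext x
        rw [MvPowerSeries.coeff_truncTotal_eq_ite]
        split_ifs with h
        · obtain rfl : x = 0 := (Finsupp.degree_eq_zero_iff x).1 (by simpa using h)
          simpa using hp
        · simp
      rw [h0]
      exact zero_mem _
    rw [← AdicCompletion.pow_smul_top_eq_ker_eval (idealOfVars_fg σ R), pow_one] at hmem
    have key : ∀ y ∈ (idealOfVars σ R • ⊤ : Submodule (MvPolynomial σ R)
        (AdicCompletion (idealOfVars σ R) (MvPolynomial σ R))),
        (MvPowerSeries.toAdicCompletionAlgEquiv σ R).symm y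
          ∈ Ideal.span (Set.range (MvPowerSeries.X : σ → MvPowerSeries σ R)) := by
      intro y hy
      refine Submodule.smul_induction_on hy (fun r hr z _ => ?_) (fun z w hz hw => ?_)
      · rw [map_smul, Algebra.smul_def]
        refine Ideal.mul_mem_right _ _ ?_
        have := Ideal.mem_map_of_mem (algebraMap (MvPolynomial σ R) (MvPowerSeries σ R)) hr
        rw [idealOfVars, Ideal.map_span, ← Set.range_comp] at this
        convert this using 3
        funext i
        simp [MvPowerSeries.algebraMap_apply']
      · rw [map_add]
        exact add_mem hz hw
    have h' := key _ hmem
    rwa [AlgEquiv.symm_apply_apply] at h'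
  · rintro _ ⟨i, rfl⟩
    simp [RingHom.mem_ker]

instance : IsLocalRing Base :=
  have : Nontrivial Base := baseAug.toRingHom.domain_nontrivial
  IsLocalRing.of_surjective' (Ideal.Quotient.mk relIdeal) Ideal.Quotient.mk_surjective

theorem ker_baseAug : RingHom.ker baseAug = Ideal.map (algebraMap (MvPowerSeries (Fin 5) ℂ) Base)
    (Ideal.span (Set.range MvPowerSeries.X)) := by
  rw [← mvPowerSeries_ker_constantCoeff]
  refine le_antisymm (fun x hx => ?_) (Ideal.map_le_iff_le_comap.2 fun p hp => hp)
  obtain ⟨p, rfl⟩ := Ideal.Quotient.mk_surjective x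
  exact Ideal.mem_map_of_mem _ hx

theorem isPrecomplete_of_surjective {R M N : Type*} [CommRing R] (I : Ideal R) [AddCommGroup M]
    [Module R M] [AddCommGroup N] [Module R N] [IsPrecomplete I M] (f : M →ₗ[R] N)
    (hf : Function.Surjective f) : IsPrecomplete I N := by
  rw [← AdicCompletion.of_surjective_iff]
  intro y
  obtain ⟨x, rfl⟩ := AdicCompletion.map_surjective I hf y
  obtain ⟨m, rfl⟩ := AdicCompletion.of_surjective I M x
  exact ⟨f m, (AdicCompletion.map_of I f m).symm⟩

theorem isFormalAlgebra_baseAug : IsFormalAlgebra baseAug := by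
  refine ⟨inferInstance, ?_⟩
  have hne : RingHom.ker baseAug ≠ ⊤ := RingHom.ker_ne_top _
  -- Krull's intersection theorem in the Noetherian local ring `Base`
  have h₁ : IsHausdorff (RingHom.ker baseAug) Base := IsHausdorff.of_isLocalRing _ _ hne
  have h₂ : IsPrecomplete (RingHom.ker baseAug) Base := by
    rw [ker_baseAug, IsPrecomplete.map_algebraMap_iff]
    exact isPrecomplete_of_surjective _ (Algebra.linearMap (MvPowerSeries (Fin 5) ℂ) Base)
      Ideal.Quotient.mk_surjective
  exact { toIsHausdorff := h₁, toIsPrecomplete := h₂ }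

variable {B : Type u} [CommRing B] [Algebra ℂ B]

theorem isAdicComplete_of_sq_eq_bot {S : Type*} [CommRing S] {I : Ideal S} (h : I ^ 2 = ⊥) :
    IsAdicComplete I S := by
  have hz : ∀ n, 2 ≤ n → I ^ n = ⊥ := fun n hn =>
    le_bot_iff.1 ((Ideal.pow_le_pow_right hn).trans h.le)
  refine { haus' := fun x hx => ?_, prec' := fun f hf => ⟨f 2, fun n => ?_⟩ }
  · have := hx 2
    rwa [hz 2 le_rfl, Submodule.bot_smul, SModEq.bot] at this
  · rcases le_total n 2 with hn | hn
    · exact hf hn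
    · have := hf hn
      rw [hz 2 le_rfl, Submodule.bot_smul, SModEq.bot] at this
      rw [this]

theorem IsInfinitesimalAlgebra.isFormalAlgebra {ε : B →ₐ[ℂ] ℂ} (h : IsInfinitesimalAlgebra ε) :
    IsFormalAlgebra ε :=
  ⟨h.isLocalRing, isAdicComplete_of_sq_eq_bot h.sq_eq_bot⟩

/-- Evaluation of formal power series in finitely many variables at elements of an ideal `I` of an
`I`-adically complete algebra. -/
theorem exists_algHom_mvPowerSeries {σ R S : Type*} [Finite σ] [CommRing R] [CommRing S]
    [Algebra R S] (I : Ideal S) [IsAdicComplete I S] (t : σ → S) (ht : ∀ i, t i ∈ I) :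
    ∃ F : MvPowerSeries σ R →ₐ[R] S, ∀ i, F (MvPowerSeries.X i) = t i := by
  have hle : ∀ n, MvPolynomial.idealOfVars σ R ^ n
      ≤ (I ^ n).comap (MvPolynomial.aeval (R := R) t) := by
    intro n
    refine (Ideal.pow_right_mono (Ideal.span_le.2 ?_) n).trans (Ideal.le_comap_pow _ n)
    rintro _ ⟨i, rfl⟩
    simpa using ht i
  let f : ∀ n, MvPowerSeries σ R →ₐ[R] S ⧸ I ^ n := fun n =>
    (Ideal.quotientMapₐ (I ^ n) (MvPolynomial.aeval (R := R) t) (hle n)).comp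
      ((MvPowerSeries.truncTotalAlgHom σ R n).restrictScalars R)
  have hf : ∀ n p, f n p = Ideal.Quotient.mk (I ^ n)
      (MvPolynomial.aeval t (MvPowerSeries.truncTotal n p)) := fun n p => rfl
  -- the values modulo the powers of `I` are those of the truncations
  refine ⟨IsAdicComplete.liftAlgHom I f fun {m n} hmn => AlgHom.ext fun p => ?_, fun i => ?_⟩
  · change Ideal.Quotient.factor (Ideal.pow_le_pow_right hmn) (f n p) = f m p
    rw [hf, hf, Ideal.Quotient.factor_mk, Ideal.Quotient.eq, ← map_sub]
    exact hle m (MvPowerSeries.truncTotal_sub_truncTotal_mem_pow_idealOfVars hmn le_rfl p)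
  · rw [IsHausdorff.eq_iff_smodEq (I := I)]
    intro n
    rw [smul_eq_mul, Ideal.mul_top, SModEq.sub_mem, ← Ideal.Quotient.eq,
      IsAdicComplete.mk_liftAlgHom, hf, Ideal.Quotient.eq]
    have h := hle n (x := MvPowerSeries.truncTotal n (MvPowerSeries.X i) - MvPolynomial.X i) (by
      rw [MvPolynomial.mem_pow_idealOfVars_iff']
      intro x hx
      rw [MvPolynomial.coeff_sub, MvPowerSeries.coeff_truncTotal _ hx, ← MvPolynomial.coe_X,
        MvPolynomial.coeff_coe, sub_self])
    simpa using h

theorem ker_isMaximal (ε : B →ₐ[ℂ] ℂ) : (RingHom.ker ε).IsMaximal :=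
  RingHom.ker_isMaximal_of_surjective ε fun z => ⟨algebraMap ℂ B z, ε.commutes z⟩

theorem ker_infAug : RingHom.ker infAug = Ideal.span (Set.range infParam) := by
  have hspan : Ideal.span (Set.range infParam) = Ideal.map (Ideal.Quotient.mk infIdeal)
      (MvPolynomial.idealOfVars (Fin 5) ℂ) := by
    rw [Ideal.map_span, ← Set.range_comp]
    rfl
  rw [hspan]
  refine le_antisymm (fun x hx => ?_) (Ideal.map_le_iff_le_comap.2 (Ideal.span_le.2 ?_))
  · obtain ⟨p, rfl⟩ := Ideal.Quotient.mk_surjective x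
    refine Ideal.mem_map_of_mem _ ?_
    rw [← pow_one (MvPolynomial.idealOfVars (Fin 5) ℂ), MvPolynomial.mem_pow_idealOfVars_iff']
    intro n hn
    obtain rfl : n = 0 := (Finsupp.degree_eq_zero_iff n).1 (by simpa using hn)
    have h : MvPolynomial.aeval (fun _ => (0 : ℂ)) p = 0 := hx
    simpa [MvPolynomial.constantCoeff_eq] using h
  · rintro _ ⟨i, rfl⟩
    exact MvPolynomial.aeval_X _ i

theorem isInfinitesimalAlgebra_infAug : IsInfinitesimalAlgebra infAug := by
  have hsq : RingHom.ker infAug ^ 2 = ⊥ := by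
    have h : Set.range infParam = Ideal.Quotient.mk infIdeal '' Set.range MvPolynomial.X := by
      rw [← Set.range_comp]
      rfl
    rw [ker_infAug, h, ← Ideal.map_span, ← Ideal.map_pow]
    exact Ideal.map_quotient_self infIdeal
  have := ker_isMaximal infAug
  have := isAdicComplete_of_sq_eq_bot hsq
  exact ⟨isLocalRing_of_isAdicComplete_maximal (RingHom.ker infAug), hsq⟩

theorem ker_baseAug_eq_span : RingHom.ker baseAug = Ideal.span (Set.range baseParam) := by
  rw [ker_baseAug, Ideal.map_span, ← Set.range_comp]
  rfl

theorem isDeformation_dInf {ε : B →ₐ[ℂ] ℂ} {t : Fin 5 → B} (ht : ∀ i, ε (t i) = 0)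
    (h₁ : t 0 * t 3 + t 2 * t 4 = 0) (h₂ : t 0 * t 4 - t 1 * t 2 = 0) :
    IsDeformation ε (d1 ℂ) (dInf t) := by
  refine ⟨(isCodifferential_dInf_iff t).2 ⟨h₁, h₂⟩, ?_⟩
  rw [push_dInf, d1_eq_dInf]
  exact congrArg dInf (funext ht)

theorem InfEquivalent.trans {ε : B →ₐ[ℂ] ℂ} {d d' d'' : Cochain B 2} (h : InfEquivalent ε d d')
    (h' : InfEquivalent ε d' d'') : InfEquivalent ε d d'' := by
  obtain ⟨g, hg, hd⟩ := h
  obtain ⟨g', hg', hd'⟩ := h'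
  rw [pull_eq_iff] at hd hd'
  refine ⟨g'.trans g, fun i j => ?_, (pull_eq_iff _ _ _).2 fun a b => ?_⟩
  · exact (congrFun (comp_linearEquiv_apply hg _) i).trans (hg' i j)
  · rw [LinearEquiv.trans_apply, LinearEquiv.trans_apply, LinearEquiv.trans_apply, hd, hd']

/-- Homomorphisms to `ℂ` from a local algebra with an augmentation are equal to it. -/
theorem algHom_eq_augmentation [IsLocalRing B] (ε φ : B →ₐ[ℂ] ℂ) : φ = ε := by
  have hker : RingHom.ker φ = RingHom.ker ε :=
    (IsLocalRing.eq_maximalIdeal (ker_isMaximal φ)).trans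
      (IsLocalRing.eq_maximalIdeal (ker_isMaximal ε)).symm
  refine AlgHom.ext fun x => ?_
  have h : x - algebraMap ℂ B (ε x) ∈ RingHom.ker φ := by
    rw [hker, RingHom.mem_ker, map_sub, AlgHom.commutes]
    exact sub_self _
  rw [RingHom.mem_ker, map_sub, AlgHom.commutes] at h
  exact sub_eq_zero.1 h

/-- A homomorphism to an infinitesimal algebra is determined by its values on generators of the
augmentation ideal. -/
theorem algHom_ext_of_ker_eq_span {A : Type v} [CommRing A] [Algebra ℂ A] [IsLocalRing A]
    {εA : A →ₐ[ℂ] ℂ} {ι : Type*} {p : ι → A} (hp : RingHom.ker εA = Ideal.span (Set.range p))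
    {ε : B →ₐ[ℂ] ℂ} (hε : RingHom.ker ε ^ 2 = ⊥) {f f' : A →ₐ[ℂ] B}
    (h : ∀ i, f (p i) = f' (p i)) : f = f' := by
  have haug : ∀ (F : A →ₐ[ℂ] B) (a : A), ε (F a) = εA a := fun F a =>
    DFunLike.congr_fun (algHom_eq_augmentation εA (ε.comp F)) a
  have key : ∀ y ∈ RingHom.ker εA, f y = f' y := by
    intro y hy
    rw [hp] at hy
    refine Submodule.span_induction ?_ ?_ ?_ ?_ hy
    · rintro _ ⟨i, rfl⟩
      exact h i
    · simp
    · intro x y _ _ hx hy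
      rw [map_add, map_add, hx, hy]
    · intro a y hy hfy
      have h₁ : f a - f' a ∈ RingHom.ker ε := by
        rw [RingHom.mem_ker, map_sub, haug, haug, sub_self]
      have h₂ : f y ∈ RingHom.ker ε := by
        rw [RingHom.mem_ker, haug, ← RingHom.mem_ker, hp]
        exact hy
      have h₃ : (f a - f' a) * f y ∈ RingHom.ker ε ^ 2 := by
        rw [pow_two]
        exact Ideal.mul_mem_mul h₁ h₂
      rw [hε, Ideal.mem_bot] at h₃
      rw [smul_eq_mul, map_mul, map_mul, ← hfy]
      linear_combination h₃
  refine AlgHom.ext fun x => ?_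
  have h₁ := key (x - algebraMap ℂ A (εA x)) (by
    rw [RingHom.mem_ker, map_sub, AlgHom.commutes]
    exact sub_self _)
  rw [map_sub, map_sub, AlgHom.commutes, AlgHom.commutes] at h₁
  exact sub_left_injective h₁

/-- Over an infinitesimal base there is at most one homomorphism that induces a given deformation
from the family `d^∞` with parameters generating the augmentation ideal. -/
theorem algHom_unique_of_infEquivalent {A : Type v} [CommRing A] [Algebra ℂ A] [IsLocalRing A]
    {εA : A →ₐ[ℂ] ℂ} {p : Fin 5 → A} (hp : RingHom.ker εA = Ideal.span (Set.range p))
    {ε : B →ₐ[ℂ] ℂ} (hε : RingHom.ker ε ^ 2 = ⊥) {dB : Cochain B 2} {f f' : A →ₐ[ℂ] B}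
    (hf : InfEquivalent ε (push (f : A →+* B) (dInf p)) dB)
    (hf' : InfEquivalent ε (push (f' : A →+* B) (dInf p)) dB) : f = f' := by
  have haug : ∀ (F : A →ₐ[ℂ] B) (i : Fin 5), ε (F (p i)) = 0 := by
    intro F i
    refine (DFunLike.congr_fun (algHom_eq_augmentation εA (ε.comp F)) (p i)).trans ?_
    rw [← RingHom.mem_ker, hp]
    exact Ideal.subset_span ⟨i, rfl⟩
  have h := hf.trans hf'.symm
  rw [push_dInf, push_dInf] at h
  exact algHom_ext_of_ker_eq_span hp hε fun i =>
    congrFun (h.eq_of_ker_sq_eq_bot hε (haug f) (haug f')) i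

theorem isUniversalInfinitesimal_dInf :
    IsUniversalInfinitesimal.{u} infAug (d1 ℂ) (dInf infParam) := by
  have hA := isInfinitesimalAlgebra_infAug
  have hmem : ∀ i, infParam i ∈ RingHom.ker infAug := fun i => by
    rw [ker_infAug]
    exact Ideal.subset_span ⟨i, rfl⟩
  have hmul : ∀ i j, infParam i * infParam j = 0 := fun i j => by
    have h := Ideal.mul_mem_mul (hmem i) (hmem j)
    rwa [← pow_two (RingHom.ker infAug), hA.sq_eq_bot] at h
  refine ⟨hA, isDeformation_dInf hmem (by simp [hmul]) (by simp [hmul]), ?_⟩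
  intro B _ _ ε dB hB hdB
  have := hA.isLocalRing
  have := hB.isLocalRing
  obtain ⟨t, ht, -, -, heq⟩ := hdB.exists_infEquivalent_dInf
  have hker : infIdeal ≤ RingHom.ker (MvPolynomial.aeval (R := ℂ) t) := by
    have h : infIdeal ≤ (RingHom.ker ε ^ 2).comap (MvPolynomial.aeval (R := ℂ) t) := by
      refine (Ideal.pow_right_mono (Ideal.span_le.2 ?_) 2).trans (Ideal.le_comap_pow _ 2)
      rintro _ ⟨i, rfl⟩
      simpa using ht i
    rwa [hB.sq_eq_bot] at h
  let f : InfBase →ₐ[ℂ] B := Ideal.Quotient.liftₐ infIdeal (MvPolynomial.aeval t)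
    fun a ha => hker ha
  have hf : ∀ i, f (infParam i) = t i := fun i => MvPolynomial.aeval_X t i
  refine ⟨f, ?_, fun f' hf' => algHom_unique_of_infEquivalent ker_infAug hB.sq_eq_bot hf' ?_⟩ <;>
  · change InfEquivalent ε (push _ _) dB
    rw [push_dInf]
    exact (congrArg dInf (funext hf) : dInf ((f : InfBase →+* B) ∘ infParam) = dInf t) ▸ heq

/-- The classifying homomorphism evaluates power series at the parameters of the normal form, which
satisfy the two relations. -/
theorem isVersal_dInf : IsVersal.{u} baseAug (d1 ℂ) (dInf baseParam) := by
  have hmem : ∀ i, baseParam i ∈ RingHom.ker baseAug := fun i => by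
    rw [ker_baseAug_eq_span]
    exact Ideal.subset_span ⟨i, rfl⟩
  refine ⟨isFormalAlgebra_baseAug, isDeformation_dInf hmem ?_ ?_, ?_⟩
  · exact Ideal.Quotient.eq_zero_iff_mem.2 (Ideal.subset_span (Or.inl rfl))
  · exact Ideal.Quotient.eq_zero_iff_mem.2 (Ideal.subset_span (Or.inr rfl))
  intro B _ _ ε dB hB hdB
  have := hB.isLocalRing
  have := hB.isAdicComplete
  obtain ⟨t, ht, h₁, h₂, heq⟩ := hdB.exists_infEquivalent_dInf
  obtain ⟨F, hF⟩ := exists_algHom_mvPowerSeries (R := ℂ) (RingHom.ker ε) t ht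
  have hker : relIdeal ≤ RingHom.ker F := by
    refine Ideal.span_le.2 ?_
    rintro _ (rfl | rfl)
    · simp [RingHom.mem_ker, hF, h₁]
    · simp [RingHom.mem_ker, hF, h₂]
  let f : Base →ₐ[ℂ] B := Ideal.Quotient.liftₐ relIdeal F fun a ha => hker ha
  refine ⟨f, ?_⟩
  rw [push_dInf]
  exact (congrArg dInf (funext hF) : dInf ((f : Base →+* B) ∘ baseParam) = dInf t) ▸ heq

theorem isMiniversal_dInf : IsMiniversal.{u} baseAug (d1 ℂ) (dInf baseParam) := by
  refine ⟨isVersal_dInf, fun B _ _ ε dB hB hdB => ?_⟩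
  obtain ⟨f, hf⟩ := isVersal_dInf.2.2 B ε dB hB.isFormalAlgebra hdB
  exact ⟨f, hf, fun f' hf' =>
    algHom_unique_of_infEquivalent ker_baseAug_eq_span hB.sq_eq_bot hf' hf⟩

end Formal

/-! ### Dimensions of the three pieces -/

section Dimension

open MvPolynomial

/-- If a dense open subset `{g ≠ 0}` of an affine space is mapped onto `S` by the polynomial map
`q`, then the polynomials vanishing on `S` are those killed by substitution of `q`. -/
theorem vanishingIdeal_eq_ker_aeval {m : ℕ} {S : Set (Fin 5 → ℂ)}
    (q : Fin 5 → MvPolynomial (Fin m) ℂ) (g : MvPolynomial (Fin m) ℂ) (hg : g ≠ 0)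
    (h₁ : ∀ y, eval y g ≠ 0 → (fun i => eval y (q i)) ∈ S)
    (h₂ : ∀ x ∈ S, ∃ y, x = fun i => eval y (q i)) :
    vanishingIdeal ℂ S = RingHom.ker (aeval q : MvPolynomial (Fin 5) ℂ →ₐ[ℂ] _) := by
  have heval : ∀ (y : Fin m → ℂ) (p : MvPolynomial (Fin 5) ℂ),
      eval y (aeval q p) = aeval (fun i => eval y (q i)) p := by
    intro y p
    change ((aeval y : MvPolynomial (Fin m) ℂ →ₐ[ℂ] ℂ).comp (aeval q)) p = _
    rw [comp_aeval]
    rfl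
  ext p
  rw [mem_vanishingIdeal_iff, RingHom.mem_ker]
  constructor
  · intro hp
    have hz : g * aeval q p = 0 := by
      refine MvPolynomial.funext fun y => ?_
      rw [map_mul, map_zero, heval]
      by_cases hy : eval y g = 0
      · rw [hy, zero_mul]
      · rw [hp _ (h₁ y hy), mul_zero]
    exact (mul_eq_zero.1 hz).resolve_left hg
  · intro hp x hx
    obtain ⟨y, rfl⟩ := h₂ x hx
    rw [← heval, hp, map_zero]

theorem ringKrullDim_mvPolynomial_complex (m : ℕ) :
    ringKrullDim (MvPolynomial (Fin m) ℂ) = m := by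
  rw [MvPolynomial.ringKrullDim_of_isNoetherianRing, ringKrullDim_eq_zero_of_field]
  simp

theorem algDim_eq_of_surjective {m : ℕ} {S : Set (Fin 5 → ℂ)}
    (q : Fin 5 → MvPolynomial (Fin m) ℂ) (h₁ : ∀ y, (fun i => eval y (q i)) ∈ S)
    (h₂ : ∀ x ∈ S, ∃ y, x = fun i => eval y (q i)) (h₃ : ∀ j, ∃ i, q i = X j) :
    algDim S = m := by
  have hs : Function.Surjective (aeval q : MvPolynomial (Fin 5) ℂ →ₐ[ℂ] _) := by
    rw [← AlgHom.range_eq_top, ← top_le_iff, ← adjoin_range_X, Algebra.adjoin_le_iff]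
    rintro _ ⟨j, rfl⟩
    obtain ⟨i, hi⟩ := h₃ j
    exact ⟨X i, by simp [hi]⟩
  rw [algDim, vanishingIdeal_eq_ker_aeval q 1 one_ne_zero (fun y _ => h₁ y) h₂,
    ← ringKrullDim_mvPolynomial_complex m]
  exact ringKrullDim_eq_of_ringEquiv (RingHom.quotientKerEquivOfSurjective hs)

theorem algDim_sol₁ : algDim Sol₁ = 3 := by
  refine algDim_eq_of_surjective (m := 3) ![0, X 0, 0, X 1, X 2] (fun y => by simp [Sol₁])
    (fun x hx => ⟨![x 1, x 3, x 4], ?_⟩) (fun j => ?_)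
  · funext i
    fin_cases i <;> simp [hx.1, hx.2]
  · fin_cases j
    exacts [⟨1, rfl⟩, ⟨3, rfl⟩, ⟨4, rfl⟩]

theorem algDim_sol₂ : algDim Sol₂ = 2 := by
  refine algDim_eq_of_surjective (m := 2) ![X 0, X 1, 0, 0, 0] (fun y => by simp [Sol₂])
    (fun x hx => ⟨![x 0, x 1], ?_⟩) (fun j => ?_)
  · funext i
    fin_cases i <;> simp [hx.1, hx.2.1, hx.2.2]
  · fin_cases j
    exacts [⟨0, rfl⟩, ⟨1, rfl⟩]

/-- The parametrization `(a, b, e) ↦ (a, -a²e, b, b²e, -abe)` of the third piece, on the open set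
`b ≠ 0`. -/
noncomputable def sol₃Param : Fin 5 → MvPolynomial (Fin 3) ℂ :=
  ![X 0, -(X 0 ^ 2 * X 2), X 1, X 1 ^ 2 * X 2, -(X 0 * X 1 * X 2)]

theorem vanishingIdeal_sol₃ :
    vanishingIdeal ℂ Sol₃ = RingHom.ker (aeval sol₃Param : MvPolynomial (Fin 5) ℂ →ₐ[ℂ] _) := by
  refine vanishingIdeal_eq_ker_aeval _ (X 1) (X_ne_zero 1) (fun y hy => ?_) fun x hx => ?_
  · rw [eval_X] at hy
    refine ⟨by simpa [sol₃Param] using hy, ?_, ?_⟩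
    · simp [sol₃Param]; field_simp
    · simp [sol₃Param]; field_simp
  · obtain ⟨hne, h₄, h₁⟩ := hx
    refine ⟨![x 0, x 2, x 3 / x 2 ^ 2], funext fun i => ?_⟩
    fin_cases i <;> simp [sol₃Param]
    · rw [h₁]; field_simp
    · field_simp
    · rw [h₄]; field_simp

/-- The parametrization `(a, b, e, h) ↦ (a, h, b, be, -ae)` of the hypersurface
`t¹t⁴ + t³t⁵ = 0`. -/
noncomputable def hypersurfaceParam : Fin 5 → MvPolynomial (Fin 4) ℂ :=
  ![X 0, X 3, X 1, X 1 * X 2, -(X 0 * X 2)]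

theorem ker_hypersurfaceParam_le :
    RingHom.ker (aeval hypersurfaceParam : MvPolynomial (Fin 5) ℂ →ₐ[ℂ] _)
      ≤ RingHom.ker (aeval sol₃Param : MvPolynomial (Fin 5) ℂ →ₐ[ℂ] _) := by
  have h : (aeval sol₃Param : MvPolynomial (Fin 5) ℂ →ₐ[ℂ] MvPolynomial (Fin 3) ℂ)
      = (aeval ![X 0, X 1, X 1 * X 2, -(X 0 ^ 2 * X 2)]).comp (aeval hypersurfaceParam) := by
    refine algHom_ext fun i => ?_
    fin_cases i <;> simp [sol₃Param, hypersurfaceParam] <;> ring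
  intro p hp
  rw [RingHom.mem_ker] at hp ⊢
  rw [h, AlgHom.comp_apply, hp, map_zero]

/-- The Zariski closure of the third piece lies strictly between the plane
`t² = t⁴ = t⁵ = 0` and the irreducible hypersurface `t¹t⁴ + t³t⁵ = 0`, which bounds its dimension from both sides. -/
theorem algDim_sol₃ : algDim Sol₃ = 3 := by
  have hprime₃ := RingHom.ker_isPrime
    (aeval sol₃Param : MvPolynomial (Fin 5) ℂ →ₐ[ℂ] MvPolynomial (Fin 3) ℂ)
  have hprime := RingHom.ker_isPrime
    (aeval hypersurfaceParam : MvPolynomial (Fin 5) ℂ →ₐ[ℂ] MvPolynomial (Fin 4) ℂ)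
  rw [algDim, vanishingIdeal_sol₃]
  have hle := ker_hypersurfaceParam_le
  generalize hP : RingHom.ker (aeval sol₃Param : MvPolynomial (Fin 5) ℂ →ₐ[ℂ] _) = P at *
  generalize hQ : RingHom.ker (aeval hypersurfaceParam : MvPolynomial (Fin 5) ℂ →ₐ[ℂ] _) = Q at *
  -- `t¹t⁴ + t³t⁵` vanishes on the hypersurface but not identically
  have hu₁ : ringKrullDim (MvPolynomial (Fin 5) ℂ ⧸ Q) + 1 ≤ 5 := by
    refine (ringKrullDim_succ_le_of_surjective (Ideal.Quotient.mk Q) Ideal.Quotient.mk_surjective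
      (r := X 0 * X 3 + X 2 * X 4) (mem_nonZeroDivisors_of_ne_zero fun h => ?_)
      ?_).trans (ringKrullDim_mvPolynomial_complex 5).le
    · have h' := congrArg (eval ![1, 0, 0, 1, 0]) h
      simp at h'
    · rw [Ideal.Quotient.eq_zero_iff_mem, ← hQ, RingHom.mem_ker]
      simp [hypersurfaceParam]
      ring
  -- `t¹t⁵ - t²t³` vanishes on the third piece but not on the hypersurface
  have hu₂ : ringKrullDim (MvPolynomial (Fin 5) ℂ ⧸ P) + 1
      ≤ ringKrullDim (MvPolynomial (Fin 5) ℂ ⧸ Q) := by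
    refine ringKrullDim_succ_le_of_surjective (Ideal.Quotient.factor hle)
      (Ideal.Quotient.factor_surjective hle)
      (r := Ideal.Quotient.mk Q (X 0 * X 4 - X 1 * X 2))
      (mem_nonZeroDivisors_of_ne_zero fun h => ?_) ?_
    · rw [Ideal.Quotient.eq_zero_iff_mem, ← hQ, RingHom.mem_ker] at h
      have h' := congrArg (eval ![0, 1, 0, 1]) h
      simp [hypersurfaceParam] at h'
    · rw [Ideal.Quotient.factor_mk, Ideal.Quotient.eq_zero_iff_mem, ← hP, RingHom.mem_ker]
      simp [sol₃Param]
      ring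
  -- `t⁴` vanishes on the plane but not on the third piece; `e = 0` is the inclusion of the plane
  have hl : 2 + 1 ≤ ringKrullDim (MvPolynomial (Fin 5) ℂ ⧸ P) := by
    have hker : ∀ p ∈ P,
        (aeval ![X 0, 0, X 1, 0, 0] : MvPolynomial (Fin 5) ℂ →ₐ[ℂ] MvPolynomial (Fin 2) ℂ) p
          = 0 := by
      have h : (aeval ![X 0, 0, X 1, 0, 0] : MvPolynomial (Fin 5) ℂ →ₐ[ℂ] MvPolynomial (Fin 2) ℂ)
          = (aeval ![X 0, X 1, 0]).comp (aeval sol₃Param) := by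
        refine algHom_ext fun i => ?_
        fin_cases i <;> simp [sol₃Param]
      intro p hp
      rw [← hP, RingHom.mem_ker] at hp
      rw [h, AlgHom.comp_apply, hp, map_zero]
    refine (add_le_add_left (ringKrullDim_mvPolynomial_complex 2).ge 1).trans
      (ringKrullDim_succ_le_of_surjective (Ideal.Quotient.liftₐ P _ hker).toRingHom ?_
        (r := Ideal.Quotient.mk P (X 3)) (mem_nonZeroDivisors_of_ne_zero fun h => ?_) ?_)
    · refine Ideal.Quotient.lift_surjective_of_surjective _ _ fun p => ?_
      refine ⟨rename ![0, 2] p, ?_⟩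
      change aeval _ (rename _ p) = p
      rw [aeval_rename]
      have h : (![X 0, 0, X 1, 0, 0] : Fin 5 → MvPolynomial (Fin 2) ℂ) ∘ ![0, 2] = X := by
        funext i
        fin_cases i <;> rfl
      rw [h, aeval_X_left, AlgHom.id_apply]
    · rw [Ideal.Quotient.eq_zero_iff_mem, ← hP, RingHom.mem_ker] at h
      have h' := congrArg (eval ![0, 1, 1]) h
      simp [sol₃Param] at h'
    · exact aeval_X _ 3
  have hu := (add_le_add_left hu₂ 1).trans hu₁
  generalize ringKrullDim (MvPolynomial (Fin 5) ℂ ⧸ P) = x at hl hu ⊢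
  induction x using WithBot.recBotCoe with
  | bot => simp at hl
  | coe x =>
    induction x using ENat.recTopCoe with
    | top => exact absurd hu (by decide)
    | coe n =>
      norm_cast at hl hu ⊢
      have h₁ : 3 ≤ n := by exact_mod_cast hl
      have h₂ : n + 1 + 1 ≤ 5 := by exact_mod_cast hu
      obtain rfl : n = 3 := by lia
      rfl

end Dimension

end Lie3

theorem mainTheorem6 :
    -- the infinitesimal deformation: prebasis of the second cohomology, and universality
    Lie3.IsPrebasisH2 (Lie3.d1 ℂ) (Lie3.delta ℂ) ∧
    Lie3.IsUniversalInfinitesimal.{u} Lie3.infAug (Lie3.d1 ℂ) (Lie3.dInf Lie3.infParam) ∧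
    -- the same expression, over the base with two relations, is a miniversal deformation
    Lie3.IsMiniversal.{u} Lie3.baseAug (Lie3.d1 ℂ) (Lie3.dInf Lie3.baseParam) ∧
    -- the solutions of the relations
    (∀ t : Fin 5 → ℂ, Lie3.IsCodifferential (Lie3.dInf t) ↔ t ∈ Lie3.Sol) ∧
    Lie3.Sol = Lie3.Sol₁ ∪ Lie3.Sol₂ ∪ Lie3.Sol₃ ∧
    Lie3.algDim Lie3.Sol₁ = 3 ∧ Lie3.algDim Lie3.Sol₂ = 2 ∧ Lie3.algDim Lie3.Sol₃ = 3 ∧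
    -- first piece: jump deformations to `d₃` and to `d(1 : -1)`
    (∀ t ∈ Lie3.Sol₁, t 1 * t 3 + t 4 ^ 2 ≠ 0 → Lie3.JumpsThrough Lie3.Sol₁ t Lie3.d3) ∧
    (∀ t ∈ Lie3.Sol₁, t 1 * t 3 + t 4 ^ 2 = 0 → t ≠ 0 →
      Lie3.JumpsThrough Lie3.Sol₁ t (Lie3.dFam 1 (-1))) ∧
    -- second piece: jump deformations to every `d(α : β)`
    (∀ t ∈ Lie3.Sol₂, ∀ α β : ℂ, (α ≠ 0 ∨ β ≠ 0) → t 0 = α + β → t 1 = α * β →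
      Lie3.JumpsThrough Lie3.Sol₂ t (Lie3.dFam α β)) ∧
    -- third piece: jump deformations to `d(α : β)` with `α + β ≠ 0`
    (∀ t ∈ Lie3.Sol₃, ∀ α β : ℂ, t 2 = α + β → t 3 = -(α * β) →
      Lie3.JumpsThrough Lie3.Sol₃ t (Lie3.dFam α β)) ∧
    -- the points of the moduli space to which `d₁` jumps
    Lie3.JumpsTo (Lie3.d1 ℂ) Lie3.d3 ∧
    Lie3.JumpsTo (Lie3.d1 ℂ) (Lie3.dFam 1 (-1)) ∧
    (∀ α β : ℂ, (α ≠ 0 ∨ β ≠ 0) → Lie3.JumpsTo (Lie3.d1 ℂ) (Lie3.dFam α β)) ∧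
    (∀ d' : Lie3.Cochain ℂ 2, Lie3.IsCodifferential d' →
      (Lie3.JumpsTo (Lie3.d1 ℂ) d' ↔
        d' ≠ 0 ∧ ¬ Lie3.Equivalent (Lie3.d1 ℂ) d' ∧ ¬ Lie3.Equivalent Lie3.d2 d')) := by
  exact ⟨Lie3.isPrebasisH2_delta, Lie3.isUniversalInfinitesimal_dInf, Lie3.isMiniversal_dInf,
    Lie3.isCodifferential_dInf_iff_mem_sol, Lie3.sol_eq_union, Lie3.algDim_sol₁, Lie3.algDim_sol₂,
    Lie3.algDim_sol₃, fun _ ht hq => Lie3.jumpsThrough_sol₁_d3 ht hq,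
    fun _ ht hq hne => Lie3.jumpsThrough_sol₁_dFam ht hq hne,
    fun _ ht _ _ hαβ h₀ h₁ => Lie3.jumpsThrough_sol₂ ht hαβ h₀ h₁,
    fun _ ht _ _ h₂ h₃ => Lie3.jumpsThrough_sol₃ ht h₂ h₃, Lie3.jumpsTo_d3,
    Lie3.jumpsTo_dFam (Or.inl one_ne_zero), fun _ _ hαβ => Lie3.jumpsTo_dFam hαβ,
    fun _ hd' => Lie3.jumpsTo_d1_iff hd'⟩
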